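/- **Setting.** Let $\lambda>1$, $\eta>0$, $\Omega\ge 0$, $\Gamma\ge 0$. The plant is $X_0=0$, $X_{t+1}=\lambda X_t+U_t+W_t$, where $(W_t)$ is an arbitrary sequence with $|W_t|\le \Omega/2$. A discrete memoryless channel with finite alphabets $\mathcal A,\mathcal B$ and transition probabilities $P(b|a)$ is used once per time step: at time $t$ an observer produces the channel input $a_t\in\mathcal A$, the channel outputs $B_t\sim P(\cdot|a_t)$, and a controller produces $U_t$. The observer has no feedback: $a_t$ depends only on the noisy observations $X_i+N_i$, $0\le i\le t$, where $(N_t)$ is an arbitrary sequence with $|N_t|\le\Gamma/2$, and on common randomness. The control $U_t$ depends only on $B_0,\dots,B_t$ and on the common randomness. The closed loop is $\eta$-stable if there is a constant $K$ such that $E|X_t|^\eta\le K$ for all $t\ge 0$ and all such sequences $(W_t)$, $(N_t)$; the expectation is over the channel and the common randomness. For a distribution $Q$ on $\mathcal A$ let $$E_0(\rho,Q)=-\log_2\sum_{b}\Big(\sum_a Q(a)P(b|a)^{1/(1+\rho)}\Big)^{1+\rho},\quad E_r(R,Q)=\max_{0\le\rho\le1}\big(E_0(\rho,Q)-\rho R\big),\quad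 E_r(R)=\max_Q E_r(R,Q).$$ For $\Delta>0$ and $j\in\mathbb Z$, bin $j$ is the interval $(\Delta\frac j2,\Delta(\frac j2+1)]$; the $\Delta$-lattice quantizer assigns $x$ to the bin $j$ with $x\in(\Delta(\frac j2+\frac14),\Delta(\frac j2+\frac34)]$. Given $n\ge 1$, let the labels $A_{k,j}\in\mathcal A^n$ ($k\ge0$, $j\in\mathbb Z$) be i.i.d., each consisting of $n$ i.i.d. letters of law $Q$; they are the common randomness. The *time-varying randomly labeled $\Delta$-lattice observer* quantizes the noisy observation at time $kn$, $k=0,1,2,\dots$, to a bin $j$ and sends the word $A_{k,j}$ at times $kn,\dots,kn+n-1$. A *maximum-likelihood trellis-search controller* applies $U_t=0$ unless $t=kn+n-1$ for some $k\ge 0$. At time $kn+n-1$ it considers the trellis paths $(j_0,\dots,j_k)$: bin $j_0$ contains $0$, and for each $i<k$ some state in bin $j_i$ at time $in$ can be carried, under the controls actually applied and some disturbances bounded by $\Omega/2$, into bin $j_{i+1}$ at time $(i+1)n$. It picks a path that maximizes the likelihood $\prod_{i=0}^{k}\prod_{m=0}^{n-1}P\big(B_{in+m}\,\big|\,(A_{i,j_i})_m\big)$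 and applies $U_t=-\lambda^n c$, where $c=\Delta(\frac{j_k}2+\frac12)$ is the center of the last bin of the path. (Ties may be broken in any fixed measurable way.) **Theorem.** Suppose that $E_r(R)>\eta\log_2\lambda$ for some $R>\log_2\lambda$. Then the plant can be made $\eta$-stable over the channel without feedback, with boundedly noisy state observations. More precisely, a distribution attaining the maximum in $E_r(R)=\max_Q E_r(R,Q)$ exists, and for every such $Q$ there are $n\ge1$ and $\Delta>0$ such that the time-varying randomly labeled $\Delta$-lattice observer, with labels drawn i.i.d. in $\mathcal A^n$ with letters of law $Q$, together with some maximum-likelihood trellis-search controller that shares the labels, makes the closed loop $\eta$-stable. -/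

import Mathlib

open MeasureTheory
open scoped ENNReal NNReal

namespace ControlOverDMC

/-! ### Gallager's random coding exponent, in base 2 -/

/-- Gallager's function
`E₀(ρ, Q) = - log₂ ∑_b (∑_a Q(a) P(b|a)^{1/(1+ρ)})^{1+ρ}`. -/
noncomputable def gallagerE0 {A B : Type*} [Fintype A] [Fintype B]
    (P : A → PMF B) (Q : PMF A) (ρ : ℝ) : ℝ :=
  -Real.logb 2 (∑ b, (∑ a, (Q a).toReal * (P a b).toReal ^ (1 / (1 + ρ))) ^ (1 + ρ))

/-- `E_r(R, Q) = max_{0 ≤ ρ ≤ 1} (E₀(ρ, Q) - ρ R)`. -/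
noncomputable def randomCodingExponentAt {A B : Type*} [Fintype A] [Fintype B]
    (P : A → PMF B) (R : ℝ) (Q : PMF A) : ℝ :=
  sSup ((fun ρ : ℝ => gallagerE0 P Q ρ - ρ * R) '' Set.Icc 0 1)

/-- The random coding exponent `E_r(R) = max_Q E_r(R, Q)`, over all input distributions `Q`. -/
noncomputable def randomCodingExponent {A B : Type*} [Fintype A] [Fintype B]
    (P : A → PMF B) (R : ℝ) : ℝ :=
  ⨆ Q : PMF A, randomCodingExponentAt P R Q

/-- `Q` maximizes the random coding exponent at rate `R`. -/
def IsOptimalInput {A B : Type*} [Fintype A] [Fintype B]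
    (P : A → PMF B) (R : ℝ) (Q : PMF A) : Prop :=
  ∀ Q' : PMF A, randomCodingExponentAt P R Q' ≤ randomCodingExponentAt P R Q

/-! ### The plant, the observer, the controller and the closed loop -/

/-- `X₀ = x₀`, `X_{t+1} = lam X_t + u_t + w_t`. -/
noncomputable def plantState (lam x₀ : ℝ) (u w : ℕ → ℝ) : ℕ → ℝ
  | 0 => x₀
  | t + 1 => lam * plantState lam x₀ u w t + u t + w t

/-- An observer without feedback: the channel input at time `t` is a function of the common
randomness and of the state observations made at times `0, …, t` only (neither the channel outputs
nor the controls are seen). -/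
structure Observer (Θ A : Type*) [MeasurableSpace Θ] [MeasurableSpace A] where
  act : (t : ℕ) → Θ → (Fin (t + 1) → ℝ) → A
  measurable_act : ∀ t, Measurable fun q : Θ × (Fin (t + 1) → ℝ) => act t q.1 q.2

/-- A controller: the control at time `t` is a function of the common randomness and of the channel
outputs at times `0, …, t`. -/
structure Controller (Θ B : Type*) [MeasurableSpace Θ] where
  act : (t : ℕ) → Θ → (Fin (t + 1) → B) → ℝ
  measurable_act : ∀ t b, Measurable fun θ : Θ => act t θ b

/-- The controls applied at times `t < T` when the common randomness is `θ` and the channel outputs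
are `b₀, …, b_{T-1}` (and `0` at later times, which are never used). -/
noncomputable def controls {Θ B : Type*} [MeasurableSpace Θ] (C : Controller Θ B) (θ : Θ)
    {T : ℕ} (b : Fin T → B) (t : ℕ) : ℝ :=
  if h : t < T then C.act t θ (fun i => b (Fin.castLE h i)) else 0

/-- The closed-loop state at time `t ≤ T`, with `X₀ = 0`, common randomness `θ`, disturbances `w`
and channel outputs `b₀, …, b_{T-1}`. -/
noncomputable def closedLoopState {Θ B : Type*} [MeasurableSpace Θ] (lam : ℝ)
    (C : Controller Θ B) (w : ℕ → ℝ) (θ : Θ) {T : ℕ} (b : Fin T → B) (t : ℕ) : ℝ :=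
  plantState lam 0 (controls C θ b) w t

/-- The closed-loop channel input at time `t ≤ T`: the observer sees `X_i + ν_i` for `i ≤ t`. -/
noncomputable def channelInput {Θ A B : Type*} [MeasurableSpace Θ] [MeasurableSpace A] (lam : ℝ)
    (O : Observer Θ A) (C : Controller Θ B) (w ν : ℕ → ℝ) (θ : Θ) {T : ℕ} (b : Fin T → B)
    (t : ℕ) : A :=
  O.act t θ fun i => closedLoopState lam C w θ b i + ν i

/-- The closed-loop probability, given the common randomness `θ`, that the first `T` outputs of the
memoryless channel `P` are `b₀, …, b_{T-1}`: the product of the `P(b_t | a_t)`, where `a_t` is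
determined by `θ` and `b₀, …, b_{t-1}`. -/
noncomputable def outputProb {Θ A B : Type*} [MeasurableSpace Θ] [MeasurableSpace A]
    (P : A → PMF B) (lam : ℝ) (O : Observer Θ A) (C : Controller Θ B) (w ν : ℕ → ℝ) (θ : Θ)
    {T : ℕ} (b : Fin T → B) : ℝ≥0∞ :=
  ∏ t : Fin T, P (channelInput lam O C w ν θ b t) (b t)

/-- `E[|X_T|^η]` in closed loop, over the channel and the common randomness (of law `μ`). -/
noncomputable def stateMoment {Θ A B : Type*} [MeasurableSpace Θ] [MeasurableSpace A] [Fintype B]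
    (μ : Measure Θ) (P : A → PMF B) (lam η : ℝ) (O : Observer Θ A) (C : Controller Θ B)
    (w ν : ℕ → ℝ) (T : ℕ) : ℝ≥0∞ :=
  ∫⁻ θ, ∑ b : Fin T → B, outputProb P lam O C w ν θ b *
    ENNReal.ofReal (|closedLoopState lam C w θ b T| ^ η) ∂μ

/-- The closed loop is `η`-stable: one constant bounds `E[|X_t|^η]` at all times, for all
disturbance sequences bounded by `Ω/2` and all observation noise sequences bounded by `Γ/2`. -/
def IsEtaStable {Θ A B : Type*} [MeasurableSpace Θ] [MeasurableSpace A] [Fintype B]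
    (μ : Measure Θ) (P : A → PMF B) (lam Ω Γ η : ℝ) (O : Observer Θ A)
    (C : Controller Θ B) : Prop :=
  ∃ K : ℝ≥0, ∀ w ν : ℕ → ℝ, (∀ t, |w t| ≤ Ω / 2) → (∀ t, |ν t| ≤ Γ / 2) →
    ∀ t, stateMoment μ P lam η O C w ν t ≤ K

/-! ### Randomly labeled lattice quantizers -/

/-- The bin to which the `Δ`-lattice quantizer assigns `x`: the integer `j` with
`Δ (j/2 + 1/4) < x ≤ Δ (j/2 + 3/4)`. -/
noncomputable def quantize (Δ x : ℝ) : ℤ := ⌈2 * x / Δ - 1 / 2⌉ - 1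

theorem quantize_eq_iff {Δ : ℝ} (hΔ : 0 < Δ) (x : ℝ) (j : ℤ) :
    quantize Δ x = j ↔ x ∈ Set.Ioc (Δ * (j / 2 + 1 / 4)) (Δ * (j / 2 + 3 / 4)) := by
  have h1 : quantize Δ x = j ↔ ⌈2 * x / Δ - 1 / 2⌉ = j + 1 := by
    unfold quantize; omega
  have e : 2 * x / Δ = 2 * (x / Δ) := by ring
  rw [h1, Int.ceil_eq_iff, Set.mem_Ioc, mul_comm Δ, mul_comm Δ, ← lt_div_iff₀ hΔ,
    ← div_le_iff₀ hΔ, e]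
  push_cast
  constructor <;> rintro ⟨h, h'⟩ <;> constructor <;> linarith

theorem measurable_quantize (Δ : ℝ) : Measurable (quantize Δ) := by
  unfold quantize
  have h : Measurable fun x : ℝ => ⌈2 * x / Δ - 1 / 2⌉ :=
    Int.measurable_ceil.comp (by fun_prop)
  exact (measurable_of_countable fun z : ℤ => z - 1).comp h

/-- The interval `(Δ j/2, Δ (j/2 + 1)]` spanned by bin `j`; neighbouring bins overlap by half. -/
def bin (Δ : ℝ) (j : ℤ) : Set ℝ := Set.Ioc (Δ * (j / 2)) (Δ * (j / 2 + 1))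

/-- The center of bin `j`. -/
noncomputable def binCenter (Δ : ℝ) (j : ℤ) : ℝ := Δ * (j / 2 + 1 / 2)

/-- Label tables: a word of `n` channel inputs for each pair (sampling stage `k`, bin `j`). -/
abbrev Labels (n : ℕ) (A : Type*) : Type _ := ℕ × ℤ → Fin n → A

/-- The labels are i.i.d. over stages and bins, each being a word of `n` i.i.d. letters of
law `Q`. -/
noncomputable def labelLaw {A : Type*} [MeasurableSpace A] (n : ℕ) (Q : PMF A) :
    Measure (Labels n A) :=
  Measure.infinitePi fun _ => Measure.pi fun _ => Q.toMeasure

/-- The time-varying randomly labeled `Δ`-lattice observer: the observation made at time `k n` is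
quantized, and the label of its bin in stage `k` is sent at the times `k n, …, k n + n - 1`. -/
noncomputable def latticeObserver {A : Type*} [MeasurableSpace A] (n : ℕ) (hn : 0 < n) (Δ : ℝ) :
    Observer (Labels n A) A where
  act t θ y :=
    θ (t / n, quantize Δ (y ⟨t / n * n, Nat.lt_succ_of_le (Nat.div_mul_le_self t n)⟩))
      ⟨t % n, Nat.mod_lt t hn⟩
  measurable_act t := by
    have h : Measurable fun q : Labels n A × ℤ => q.1 (t / n, q.2) ⟨t % n, Nat.mod_lt t hn⟩ :=
      measurable_from_prod_countable_left fun j =>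
        (measurable_pi_apply _).comp (measurable_pi_apply (t / n, j))
    exact h.comp (measurable_fst.prodMk ((measurable_quantize Δ).comp (by fun_prop)))

/-! ### Maximum-likelihood search through the trellis of bins -/

/-- An edge of the trellis from bin `j` in stage `i` to bin `j'` in stage `i + 1`: under the applied
controls `u` some state in bin `j` at time `i n` can be moved, by some admissible disturbances,
into bin `j'` at time `(i + 1) n`. -/
def IsTrellisEdge (lam Ω Δ : ℝ) (n : ℕ) (u : ℕ → ℝ) (i : ℕ) (j j' : ℤ) : Prop :=
  ∃ x ∈ bin Δ j, ∃ w : ℕ → ℝ, (∀ t, |w t| ≤ Ω / 2) ∧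
    plantState lam x (fun s => u (i * n + s)) w n ∈ bin Δ j'

/-- The paths through stages `0, …, k` of the trellis start in a bin that contains `X₀ = 0`. -/
def IsTrellisPath (lam Ω Δ : ℝ) (n : ℕ) (u : ℕ → ℝ) (k : ℕ) (p : Fin (k + 1) → ℤ) : Prop :=
  (0 : ℝ) ∈ bin Δ (p 0) ∧
    ∀ i : Fin k, IsTrellisEdge lam Ω Δ n u i (p i.castSucc) (p i.succ)

/-- The likelihood of a path, given the labels `θ` and the outputs `b` of stages `0, …, k`. Here
`finProdFinEquiv (i, m)` is the time `i n + m`. -/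
noncomputable def pathLikelihood {A B : Type*} (P : A → PMF B) (n : ℕ) (θ : Labels n A) (k : ℕ)
    (b : Fin ((k + 1) * n) → B) (p : Fin (k + 1) → ℤ) : ℝ≥0∞ :=
  ∏ i : Fin (k + 1), ∏ m : Fin n, P (θ (i, p i) m) (b (finProdFinEquiv (i, m)))

/-- A maximum-likelihood path through the trellis built from the applied controls `u`. -/
def IsMLPath {A B : Type*} (P : A → PMF B) (lam Ω Δ : ℝ) (n : ℕ) (θ : Labels n A) (u : ℕ → ℝ)
    (k : ℕ) (b : Fin ((k + 1) * n) → B) (p : Fin (k + 1) → ℤ) : Prop :=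
  IsTrellisPath lam Ω Δ n u k p ∧
    ∀ q, IsTrellisPath lam Ω Δ n u k q →
      pathLikelihood P n θ k b q ≤ pathLikelihood P n θ k b p

/-- A maximum-likelihood trellis-search controller (ties may be broken in any way). At the end of
each stage `k`, at time `(k + 1) n - 1`, it takes the last bin of a maximum-likelihood path through
the trellis given by its own past controls, and applies the control that would cancel the
uncontrolled motion over the stage of a state at the center of that bin. At other times it applies
no control. -/
def IsMLTrellisController {A B : Type*} [MeasurableSpace A] (P : A → PMF B) (lam Ω Δ : ℝ) (n : ℕ)
    (C : Controller (Labels n A) B) : Prop :=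
  (∀ t θ b, ¬ n ∣ t + 1 → C.act t θ b = 0) ∧
  ∀ (θ : Labels n A) (k : ℕ) (b : Fin ((k + 1) * n) → B), ∃ p : Fin (k + 1) → ℤ,
    IsMLPath P lam Ω Δ n θ (controls C θ b) k b p ∧
      controls C θ b ((k + 1) * n - 1) = -lam ^ n * binCenter Δ (p (Fin.last k))

end ControlOverDMC

/-!
Why the loop is stable. In stage `k` (times `k n, …, k n + n - 1`) the observer sends the label of
the bin to which it quantizes its observation. If the bins are wide compared with the observation
noise, the state lies in that bin, so these *true* bins form a path through the trellis. If the
path decoded at the end of stage `k` ends in the true bin, the applied control brings the state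
back to a bounded region. Otherwise let `i` be the start of the last run of stages, ending with
`k`, in which the decoded path avoids the true one. Two trellis paths separate by a factor of
about `lam ^ n` per stage, so the state is of the order of `lam ^ (n (k + 1 - i))`
(`Loop.state_le_or_exists_departure`). By splicing the decoded path up to stage `i - 1` with the
true path from stage `i` on, maximality of the likelihood shows that the rival segment is at least
as likely as the true segment over stages `i, …, k`.

The probability of the latter is bounded as in Gallager's random coding argument, with `s = 1 / (1
+ ρ)`: a probability `p` and a rival likelihood `p' ≥ p` satisfy `p ≤ p ^ s * (p' ^ s) ^ ρ`, and
the sum over all rivals is averaged over the labels. The true bin and the trellis depend on the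
earlier outputs and labels through the controls, so the average cannot be taken over all labels at
once. It is taken stage by stage: given the past, the true bin of a stage and the weights of the
rival paths entering it are fixed, while its labels are fresh and i.i.d., and Jensen's inequality
gains a factor `2 ^ (-n E₀(ρ, Q))` (`lintegral_stage_le`). The next stage multiplies the number of
rivals by at most `2 ^ (n R)`, because an edge of the trellis has little more than `2 lam ^ n`
continuations and `R > log₂ lam`. Hence the rival weight over `d` stages is at most `2 ^ (-n d
(E₀(ρ, Q) - ρ R))` on average (`Loop.lintegral_rivalWeight_le_pow`), and the moment is bounded by
a geometric series of ratio `2 ^ (n (η log₂ lam - E₀(ρ, Q) + ρ R)) < 1`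
(`Loop.lintegral_sampled_moment_le`, `ratio_lt_one`).

Freshness of the labels requires a controller that does not break ties by looking at labels of
later stages; `exists_causal_isMLTrellisController` provides one. An optimal input distribution
exists by compactness of the simplex (`exists_isOptimalInput`).
-/

namespace ControlOverDMC

/-! ### The plant over one stage -/

/-- The largest displacement that disturbances bounded by `Ω / 2` can cause in `t` steps. -/
noncomputable def noiseRadius (lam Ω : ℝ) (t : ℕ) : ℝ := Ω / 2 * ∑ s ∈ Finset.range t, lam ^ s

theorem noiseRadius_succ (lam Ω : ℝ) (t : ℕ) :
    noiseRadius lam Ω (t + 1) = lam * noiseRadius lam Ω t + Ω / 2 := by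
  rw [noiseRadius, geom_sum_succ, noiseRadius]; ring

theorem noiseRadius_nonneg {lam Ω : ℝ} (hlam : 0 ≤ lam) (hΩ : 0 ≤ Ω) (t : ℕ) :
    0 ≤ noiseRadius lam Ω t :=
  mul_nonneg (by positivity) (Finset.sum_nonneg fun _ _ => by positivity)

theorem noiseRadius_mono {lam Ω : ℝ} (hlam : 0 ≤ lam) (hΩ : 0 ≤ Ω) :
    Monotone (noiseRadius lam Ω) := by
  intro s t hst
  refine mul_le_mul_of_nonneg_left ?_ (by positivity)
  exact Finset.sum_le_sum_of_subset_of_nonneg (Finset.range_subset_range.2 hst)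
    fun _ _ _ => by positivity

theorem plantState_add (lam x : ℝ) (u w : ℕ → ℝ) (T s : ℕ) :
    plantState lam x u w (T + s) = plantState lam (plantState lam x u w T)
      (fun i => u (T + i)) (fun i => w (T + i)) s := by
  induction s with
  | zero => rfl
  | succ s ih => rw [← add_assoc, plantState, ih, plantState]

theorem plantState_congr {lam x : ℝ} {u u' w : ℕ → ℝ} {t : ℕ} (h : ∀ s < t, u s = u' s) :
    plantState lam x u w t = plantState lam x u' w t := by
  induction t with
  | zero => rfl
  | succ t ih =>
    rw [plantState, plantState, ih fun s hs => h s (hs.trans t.lt_succ_self), h t t.lt_succ_self]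

theorem abs_plantState_sub_le_of_idle {lam Ω x : ℝ} {u w : ℕ → ℝ} (hlam : 0 ≤ lam)
    (hw : ∀ t, |w t| ≤ Ω / 2) {t : ℕ} (hu : ∀ s < t, u s = 0) :
    |plantState lam x u w t - lam ^ t * x| ≤ noiseRadius lam Ω t := by
  induction t with
  | zero => simp [plantState, noiseRadius]
  | succ t ih =>
    have ih := ih fun s hs => hu s (hs.trans t.lt_succ_self)
    rw [plantState, hu t t.lt_succ_self, noiseRadius_succ]
    calc |lam * plantState lam x u w t + 0 + w t - lam ^ (t + 1) * x|
        = |lam * (plantState lam x u w t - lam ^ t * x) + w t| := by congr 1; ring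
      _ ≤ |lam * (plantState lam x u w t - lam ^ t * x)| + |w t| := abs_add_le _ _
      _ ≤ lam * noiseRadius lam Ω t + Ω / 2 := by
        rw [abs_mul, abs_of_nonneg hlam]
        exact add_le_add (mul_le_mul_of_nonneg_left ih hlam) (hw t)

/-- Over a stage of `n` steps in which only the last control is nonzero, the state moves to
`lam ^ n * x + u (n - 1)` up to the accumulated disturbances. -/
theorem abs_plantState_stage_sub_le {lam Ω x : ℝ} {u w : ℕ → ℝ} (hlam : 0 ≤ lam)
    (hw : ∀ t, |w t| ≤ Ω / 2) {n : ℕ} (hn : 0 < n) (hu : ∀ s, s + 1 < n → u s = 0) :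
    |plantState lam x u w n - (lam ^ n * x + u (n - 1))| ≤ noiseRadius lam Ω n := by
  obtain ⟨t, rfl⟩ : ∃ t, n = t + 1 := ⟨n - 1, by omega⟩
  have ih : |plantState lam x u w t - lam ^ t * x| ≤ noiseRadius lam Ω t :=
    abs_plantState_sub_le_of_idle hlam hw fun s hs => hu s (by omega)
  rw [plantState, noiseRadius_succ, Nat.add_sub_cancel]
  calc |lam * plantState lam x u w t + u t + w t - (lam ^ (t + 1) * x + u t)|
      = |lam * (plantState lam x u w t - lam ^ t * x) + w t| := by congr 1; ring
    _ ≤ |lam * (plantState lam x u w t - lam ^ t * x)| + |w t| := abs_add_le _ _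
    _ ≤ lam * noiseRadius lam Ω t + Ω / 2 := by
      rw [abs_mul, abs_of_nonneg hlam]
      exact add_le_add (mul_le_mul_of_nonneg_left ih hlam) (hw t)

/-! ### Bins and trellis edges -/

theorem abs_sub_binCenter_le {Δ x : ℝ} {j : ℤ} (hx : x ∈ bin Δ j) :
    |x - binCenter Δ j| ≤ Δ / 2 := by
  obtain ⟨h1, h2⟩ := hx
  rw [binCenter, abs_le]
  constructor <;> linarith

theorem mem_bin_quantize_add {Δ Γ x ν : ℝ} (hΔ : 0 < Δ) (hΓ : 2 * Γ ≤ Δ) (hν : |ν| ≤ Γ / 2) :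
    x ∈ bin Δ (quantize Δ (x + ν)) := by
  obtain ⟨h1, h2⟩ := (quantize_eq_iff hΔ (x + ν) _).1 rfl
  rw [abs_le] at hν
  constructor <;> nlinarith

/-- How far the center of the next bin on a trellis path can lie from the position that the
applied control and the center of the current bin predict. -/
noncomputable def edgeRadius (lam Ω Δ : ℝ) (n : ℕ) : ℝ :=
  lam ^ n * (Δ / 2) + noiseRadius lam Ω n + Δ / 2

theorem half_le_edgeRadius {lam Ω Δ : ℝ} (hlam : 0 ≤ lam) (hΩ : 0 ≤ Ω) (hΔ : 0 < Δ) (n : ℕ) :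
    Δ / 2 ≤ edgeRadius lam Ω Δ n := by
  have := noiseRadius_nonneg hlam hΩ n
  have : 0 ≤ lam ^ n * (Δ / 2) := by positivity
  rw [edgeRadius]; linarith

theorem IsTrellisEdge.abs_binCenter_sub_le {lam Ω Δ : ℝ} {n i : ℕ} {u : ℕ → ℝ} {j j' : ℤ}
    (h : IsTrellisEdge lam Ω Δ n u i j j') (hlam : 0 ≤ lam) (hn : 0 < n)
    (hu : ∀ s, s + 1 < n → u (i * n + s) = 0) :
    |binCenter Δ j' - (lam ^ n * binCenter Δ j + u (i * n + (n - 1)))| ≤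
      edgeRadius lam Ω Δ n := by
  obtain ⟨x, hx, w, hw, hx'⟩ := h
  have h1 := abs_sub_binCenter_le hx
  have h2 := abs_sub_binCenter_le hx'
  have h3 := abs_plantState_stage_sub_le (x := x) hlam hw hn hu
  set y := plantState lam x (fun s => u (i * n + s)) w n
  calc |binCenter Δ j' - (lam ^ n * binCenter Δ j + u (i * n + (n - 1)))|
      = |lam ^ n * (x - binCenter Δ j) + (y - (lam ^ n * x + u (i * n + (n - 1))))
          - (y - binCenter Δ j')| := by congr 1; ring
    _ ≤ |lam ^ n * (x - binCenter Δ j) + (y - (lam ^ n * x + u (i * n + (n - 1))))|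
          + |y - binCenter Δ j'| := abs_sub _ _
    _ ≤ |lam ^ n * (x - binCenter Δ j)| + |y - (lam ^ n * x + u (i * n + (n - 1)))|
          + |y - binCenter Δ j'| := by gcongr; exact abs_add_le _ _
    _ ≤ edgeRadius lam Ω Δ n := by
      rw [abs_mul, abs_of_nonneg (pow_nonneg hlam n), edgeRadius]; gcongr

theorem abs_binCenter_sub_le_iff {Δ r v : ℝ} (hΔ : 0 < Δ) (j : ℤ) :
    |binCenter Δ j - v| ≤ r ↔
      j ∈ Finset.Icc ⌈2 * (v - r) / Δ - 1⌉ ⌊2 * (v + r) / Δ - 1⌋ := by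
  have h1 : 2 * (v - r) / Δ - 1 ≤ j ↔ 2 * (v - r) ≤ (j + 1) * Δ := by
    rw [sub_le_iff_le_add, div_le_iff₀ hΔ]
  have h2 : (j : ℝ) ≤ 2 * (v + r) / Δ - 1 ↔ (j + 1) * Δ ≤ 2 * (v + r) := by
    rw [le_sub_iff_add_le, le_div_iff₀ hΔ]
  rw [Finset.mem_Icc, Int.ceil_le, Int.le_floor, abs_le, binCenter, h1, h2]
  constructor <;> rintro ⟨h, h'⟩ <;> constructor <;> linarith

theorem finite_setOf_abs_binCenter_sub_le {Δ : ℝ} (hΔ : 0 < Δ) (r v : ℝ) :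
    {j : ℤ | |binCenter Δ j - v| ≤ r}.Finite := by
  simp_rw [abs_binCenter_sub_le_iff hΔ]
  exact (Finset.Icc _ _).finite_toSet

/-- The bin centers are `Δ / 2` apart, so an interval of length `2 r` contains at most
`4 r / Δ + 1` of them. -/
theorem tsum_indicator_abs_binCenter_sub_le {Δ r : ℝ} (hΔ : 0 < Δ) (hr : 0 ≤ r) (v : ℝ) :
    (∑' j : ℤ, if |binCenter Δ j - v| ≤ r then (1 : ℝ≥0∞) else 0) ≤
      ENNReal.ofReal (4 * r / Δ + 1) := by
  simp_rw [abs_binCenter_sub_le_iff hΔ]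
  set a := 2 * (v - r) / Δ - 1
  set b := 2 * (v + r) / Δ - 1
  rw [tsum_eq_sum (s := Finset.Icc ⌈a⌉ ⌊b⌋) (fun j hj => if_neg hj),
    Finset.sum_congr rfl (fun j hj => if_pos hj), Finset.sum_const, nsmul_one, Int.card_Icc,
    ← ENNReal.ofReal_natCast]
  apply ENNReal.ofReal_le_ofReal
  have hab : b - a = 4 * r / Δ := by simp only [a, b]; ring
  have h0 : 0 ≤ 4 * r / Δ := by positivity
  have h1 := Int.le_ceil a
  have h2 := Int.floor_le b
  have h3 : ((⌊b⌋ + 1 - ⌈a⌉).toNat : ℝ) = ((max (⌊b⌋ + 1 - ⌈a⌉) 0 : ℤ) : ℝ) := by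
    rw [← Int.toNat_eq_max]; norm_cast
  rw [h3, Int.cast_max]
  apply max_le
  · push_cast; linarith
  · push_cast; linarith

/-! ### Trellis paths -/

/-- The bins assigned to the noisy observations of any actual trajectory form a trellis path. -/
theorem isTrellisPath_quantize {lam Ω Γ Δ : ℝ} {n : ℕ} {u w ν : ℕ → ℝ} (hΔ : 0 < Δ)
    (hΓ : 2 * Γ ≤ Δ) (hw : ∀ t, |w t| ≤ Ω / 2) (hν : ∀ t, |ν t| ≤ Γ / 2) (k : ℕ) :
    IsTrellisPath lam Ω Δ n u k
      (fun i => quantize Δ (plantState lam 0 u w (i * n) + ν (i * n))) := by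
  constructor
  · have := mem_bin_quantize_add (x := plantState lam 0 u w 0) hΔ hΓ (hν 0)
    simpa [plantState] using this
  · intro i
    refine ⟨plantState lam 0 u w (i * n), mem_bin_quantize_add hΔ hΓ (hν _),
      fun s => w (i * n + s), fun t => hw _, ?_⟩
    rw [← plantState_add]
    have := mem_bin_quantize_add (x := plantState lam 0 u w ((i + 1) * n)) hΔ hΓ (hν ((i + 1) * n))
    simpa [add_mul] using this

theorem IsTrellisEdge.congr {lam Ω Δ : ℝ} {n i : ℕ} {u u' : ℕ → ℝ} {j j' : ℤ}
    (h : IsTrellisEdge lam Ω Δ n u i j j') (hu : ∀ t < (i + 1) * n, u t = u' t) :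
    IsTrellisEdge lam Ω Δ n u' i j j' := by
  obtain ⟨x, hx, w, hw, hx'⟩ := h
  refine ⟨x, hx, w, hw, ?_⟩
  rwa [← plantState_congr (u := fun s => u (i * n + s)) fun s hs => hu _ (by linarith)]

theorem IsTrellisPath.congr {lam Ω Δ : ℝ} {n k : ℕ} {u u' : ℕ → ℝ} {p : Fin (k + 1) → ℤ}
    (h : IsTrellisPath lam Ω Δ n u k p) (hu : ∀ t < k * n, u t = u' t) :
    IsTrellisPath lam Ω Δ n u' k p :=
  ⟨h.1, fun i => (h.2 i).congr fun t ht =>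
    hu t (ht.trans_le (Nat.mul_le_mul_right n i.isLt))⟩

theorem IsTrellisPath.abs_binCenter_zero_le {lam Ω Δ : ℝ} {n k : ℕ} {u : ℕ → ℝ}
    {p : Fin (k + 1) → ℤ} (h : IsTrellisPath lam Ω Δ n u k p) :
    |binCenter Δ (p 0)| ≤ Δ / 2 := by
  simpa using abs_sub_binCenter_le h.1

theorem finite_setOf_isTrellisPath {lam Ω Δ : ℝ} {n : ℕ} {u : ℕ → ℝ} (hlam : 0 ≤ lam)
    (hΔ : 0 < Δ) (hn : 0 < n) (hu : ∀ t, ¬ n ∣ t + 1 → u t = 0) (k : ℕ) :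
    {p | IsTrellisPath lam Ω Δ n u k p}.Finite := by
  have key : ∀ i (hi : i < k + 1), ∃ F : Set ℤ, F.Finite ∧
      ∀ p, IsTrellisPath lam Ω Δ n u k p → p ⟨i, hi⟩ ∈ F := by
    intro i
    induction i with
    | zero =>
      refine fun hi => ⟨_, finite_setOf_abs_binCenter_sub_le hΔ (Δ / 2) 0, fun p hp => ?_⟩
      simpa using hp.abs_binCenter_zero_le
    | succ i ih =>
      intro hi
      obtain ⟨F, hF, hp⟩ := ih (by omega)
      refine ⟨⋃ j ∈ F, {j' | |binCenter Δ j' - (lam ^ n * binCenter Δ j + u (i * n + (n - 1)))| ≤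
        edgeRadius lam Ω Δ n},
        hF.biUnion fun j _ => finite_setOf_abs_binCenter_sub_le hΔ _ _, fun p hpp => ?_⟩
      refine Set.mem_biUnion (hp p hpp) ?_
      refine (hpp.2 ⟨i, by omega⟩).abs_binCenter_sub_le hlam hn fun s hs => hu _ ?_
      rw [add_assoc, Nat.dvd_add_right (dvd_mul_left n i)]
      exact Nat.not_dvd_of_pos_of_lt s.succ_pos hs
  choose F hF hp using key
  refine (Set.Finite.pi' fun i : Fin (k + 1) => hF i i.isLt).subset fun p hpp i => hp i i.isLt p hpp

/-! ### Fresh labels -/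

/-- Replacing the coordinates in `S` of an i.i.d. family by those of an independent copy does not
change its law. -/
theorem measurePreserving_piecewise {ι α : Type*} [MeasurableSpace α] (κ : Measure α)
    [IsProbabilityMeasure κ] (S : Set ι) [DecidablePred (· ∈ S)] :
    MeasurePreserving (fun q : (ι → α) × (ι → α) => S.piecewise q.2 q.1)
      ((Measure.infinitePi fun _ => κ).prod (Measure.infinitePi fun _ => κ))
      (Measure.infinitePi fun _ => κ) := by
  have hm : Measurable fun q : (ι → α) × (ι → α) => S.piecewise q.2 q.1 := by
    refine measurable_pi_lambda _ fun i => ?_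
    by_cases hi : i ∈ S
    · simp only [Set.piecewise, hi, if_true]; fun_prop
    · simp only [Set.piecewise, hi, if_false]; fun_prop
  refine ⟨hm, Measure.eq_infinitePi _ fun s t ht => ?_⟩
  rw [Measure.map_apply hm (MeasurableSet.pi s.countable_toSet fun i _ => ht i)]
  have hpre : (fun q : (ι → α) × (ι → α) => S.piecewise q.2 q.1) ⁻¹' ((s : Set ι).pi t) =
      ((s.filter (· ∉ S) : Finset ι) : Set ι).pi t ×ˢ
        ((s.filter (· ∈ S) : Finset ι) : Set ι).pi t := by
    ext q
    simp only [Set.mem_preimage, Set.mem_pi, Set.mem_prod, Finset.mem_coe, Finset.mem_filter]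
    constructor
    · refine fun h => ⟨fun i hi => ?_, fun i hi => ?_⟩
      · simpa [Set.piecewise, hi.2] using h i hi.1
      · simpa [Set.piecewise, hi.2] using h i hi.1
    · intro h i hi
      by_cases hS : i ∈ S
      · simpa [Set.piecewise, hS] using h.2 i ⟨hi, hS⟩
      · simpa [Set.piecewise, hS] using h.1 i ⟨hi, hS⟩
  rw [hpre, Measure.prod_prod, Measure.infinitePi_pi _ fun i _ => ht i,
    Measure.infinitePi_pi _ fun i _ => ht i, mul_comm]
  exact Finset.prod_filter_mul_prod_filter_not s (· ∈ S) _

theorem lintegral_infinitePi_eq_lintegral_piecewise {ι α : Type*} [MeasurableSpace α]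
    (κ : Measure α) [IsProbabilityMeasure κ] (S : Set ι) [DecidablePred (· ∈ S)]
    {F : (ι → α) → ℝ≥0∞} (hF : Measurable F) :
    ∫⁻ θ, F θ ∂(Measure.infinitePi fun _ => κ) =
      ∫⁻ θ, ∫⁻ φ, F (S.piecewise φ θ) ∂(Measure.infinitePi fun _ => κ)
        ∂(Measure.infinitePi fun _ => κ) := by
  have h := measurePreserving_piecewise κ S
  rw [← h.lintegral_comp hF, lintegral_prod _ (by exact (hF.comp h.measurable).aemeasurable)]

theorem lintegral_rpow_le_rpow_lintegral {Ω : Type*} [MeasurableSpace Ω] (μ : Measure Ω)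
    [IsProbabilityMeasure μ] {f : Ω → ℝ≥0∞} (hf : Measurable f) {ρ : ℝ} (h0 : 0 ≤ ρ)
    (h1 : ρ ≤ 1) : ∫⁻ ω, f ω ^ ρ ∂μ ≤ (∫⁻ ω, f ω ∂μ) ^ ρ := by
  rcases h0.eq_or_lt with rfl | h0
  · simp
  · have := eLpNorm'_le_eLpNorm'_of_exponent_le h0 h1 μ hf.aestronglyMeasurable
    simp only [eLpNorm', enorm_eq_self, ENNReal.rpow_one, div_one] at this
    rwa [one_div, ENNReal.rpow_inv_le_iff h0] at this

theorem lintegral_infinitePi_eval {ι α : Type*} [MeasurableSpace α] (κ : Measure α)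
    [IsProbabilityMeasure κ] (i : ι) {f : α → ℝ≥0∞} (hf : Measurable f) :
    ∫⁻ θ : ι → α, f (θ i) ∂(Measure.infinitePi fun _ => κ) = ∫⁻ a, f a ∂κ :=
  (measurePreserving_eval_infinitePi (fun _ : ι => κ) i).lintegral_comp hf

open Classical in
/-- Gallager's estimate for one stage: the label of the true bin `J` is independent of the labels
of the competing bins, over which Jensen's inequality for `x ↦ x ^ ρ` is applied. -/
theorem lintegral_competitors_le {α : Type*} [MeasurableSpace α] (κ : Measure α)
    [IsProbabilityMeasure κ] {ρ : ℝ} (h0 : 0 ≤ ρ) (h1 : ρ ≤ 1) (m : ℕ) (J : ℤ)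
    (N : ℤ → ℝ≥0∞) {h : α → ℝ≥0∞} (hh : Measurable h) :
    ∫⁻ φ : ℕ × ℤ → α, h (φ (m, J)) * (∑' j, if j = J then 0 else h (φ (m, j)) * N j) ^ ρ
        ∂(Measure.infinitePi fun _ => κ) ≤
      (∫⁻ a, h a ∂κ) ^ (1 + ρ) * (∑' j, N j) ^ ρ := by
  have hev : ∀ j, Measurable fun φ : ℕ × ℤ → α => h (φ (m, j)) := fun j =>
    hh.comp (measurable_pi_apply _)
  have hterm : ∀ j, Measurable fun φ : ℕ × ℤ → α => if j = J then 0 else h (φ (m, j)) * N j := by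
    intro j
    split_ifs
    · exact measurable_const
    · exact (hev j).mul_const _
  have hsum : Measurable fun φ : ℕ × ℤ → α => ∑' j, if j = J then 0 else h (φ (m, j)) * N j :=
    Measurable.tsum hterm
  rw [lintegral_infinitePi_eq_lintegral_piecewise κ {(m, J)}
    ((hev J).fun_mul (hsum.pow_const ρ))]
  have hpw : ∀ θ φ : ℕ × ℤ → α,
      h (({(m, J)} : Set (ℕ × ℤ)).piecewise φ θ (m, J)) *
        (∑' j, if j = J then 0 else h (({(m, J)} : Set (ℕ × ℤ)).piecewise φ θ (m, j)) * N j) ^ ρ =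
      h (φ (m, J)) * (∑' j, if j = J then 0 else h (θ (m, j)) * N j) ^ ρ := by
    intro θ φ
    congr 2
    · simp [Set.piecewise]
    · refine tsum_congr fun j => ?_
      by_cases hj : j = J
      · simp [hj]
      · simp [Set.piecewise, hj]
  simp_rw [hpw, lintegral_mul_const _ (hev J), lintegral_infinitePi_eval κ (m, J) hh]
  rw [lintegral_const_mul _ (hsum.pow_const ρ)]
  calc (∫⁻ a, h a ∂κ) * ∫⁻ θ : ℕ × ℤ → α, (∑' j, if j = J then 0 else h (θ (m, j)) * N j) ^ ρ
        ∂(Measure.infinitePi fun _ => κ)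
      ≤ (∫⁻ a, h a ∂κ) * (∫⁻ θ : ℕ × ℤ → α, (∑' j, if j = J then 0 else h (θ (m, j)) * N j)
        ∂(Measure.infinitePi fun _ => κ)) ^ ρ := by
        gcongr; exact lintegral_rpow_le_rpow_lintegral _ hsum h0 h1
    _ ≤ (∫⁻ a, h a ∂κ) * ((∫⁻ a, h a ∂κ) * ∑' j, N j) ^ ρ := by
        gcongr
        rw [lintegral_tsum fun j => (hterm j).aemeasurable, ← ENNReal.tsum_mul_left]
        refine ENNReal.tsum_le_tsum fun j => ?_
        split_ifs
        · simp
        · rw [lintegral_mul_const _ (hev j), lintegral_infinitePi_eval κ (m, j) hh]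
    _ = (∫⁻ a, h a ∂κ) ^ (1 + ρ) * (∑' j, N j) ^ ρ := by
        rw [ENNReal.mul_rpow_of_nonneg _ _ h0, ← mul_assoc,
          ENNReal.rpow_add_of_nonneg _ _ zero_le_one h0, ENNReal.rpow_one]

open Classical in
/-- The estimate for one stage, with the true bin `J`, the weights `N` of the competing bins and
the weight `G` of the past depending on the labels of the other stages only. -/
theorem lintegral_stage_le {α Y : Type*} [MeasurableSpace α] [Fintype Y] (κ : Measure α)
    [IsProbabilityMeasure κ] {ρ : ℝ} (h0 : 0 ≤ ρ) (h1 : ρ ≤ 1) (m : ℕ)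
    {G : (ℕ × ℤ → α) → ℝ≥0∞} {J : (ℕ × ℤ → α) → ℤ} {N : (ℕ × ℤ → α) → ℤ → ℝ≥0∞}
    (hG : Measurable G) (hJ : Measurable J) (hN : ∀ j, Measurable fun θ => N θ j)
    (hG' : ∀ θ θ', (∀ i j, i ≠ m → θ (i, j) = θ' (i, j)) → G θ = G θ')
    (hJ' : ∀ θ θ', (∀ i j, i ≠ m → θ (i, j) = θ' (i, j)) → J θ = J θ')
    (hN' : ∀ θ θ', (∀ i j, i ≠ m → θ (i, j) = θ' (i, j)) → N θ = N θ')
    {h : Y → α → ℝ≥0∞} (hh : ∀ y, Measurable (h y)) :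
    ∫⁻ θ, G θ * ∑ y, h y (θ (m, J θ)) *
        (∑' j, if j = J θ then 0 else h y (θ (m, j)) * N θ j) ^ ρ
        ∂(Measure.infinitePi fun _ => κ) ≤
      (∑ y, (∫⁻ a, h y a ∂κ) ^ (1 + ρ)) *
        ∫⁻ θ, G θ * (∑' j, N θ j) ^ ρ ∂(Measure.infinitePi fun _ => κ) := by
  have hlab : Measurable fun θ : ℕ × ℤ → α => θ (m, J θ) := by
    have : Measurable fun q : (ℕ × ℤ → α) × ℤ => q.1 (m, q.2) :=
      measurable_from_prod_countable_left fun j => measurable_pi_apply (m, j)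
    exact this.comp (measurable_id.prodMk hJ)
  have hcomp : ∀ y j, Measurable fun θ : ℕ × ℤ → α =>
      if j = J θ then 0 else h y (θ (m, j)) * N θ j := fun y j =>
    Measurable.ite (measurableSet_eq_fun measurable_const hJ) measurable_const
      (((hh y).comp (measurable_pi_apply _)).mul (hN j))
  have hinner : ∀ y, Measurable fun θ : ℕ × ℤ → α => h y (θ (m, J θ)) *
      (∑' j, if j = J θ then 0 else h y (θ (m, j)) * N θ j) ^ ρ := fun y =>
    ((hh y).comp hlab).mul ((Measurable.tsum (hcomp y)).pow_const ρ)
  rw [lintegral_infinitePi_eq_lintegral_piecewise κ {p : ℕ × ℤ | p.1 = m}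
    (hG.fun_mul (Finset.measurable_fun_sum _ fun y _ => hinner y)),
    ← lintegral_const_mul _ (hG.fun_mul ((Measurable.tsum hN).pow_const ρ))]
  refine lintegral_mono fun θ => ?_
  have hpw : ∀ φ : ℕ × ℤ → α, ∀ i j, i ≠ m →
      ({p : ℕ × ℤ | p.1 = m}.piecewise φ θ) (i, j) = θ (i, j) := by
    intro φ i j hi
    simp [Set.piecewise, hi]
  have hpm : ∀ φ : ℕ × ℤ → α, ∀ j,
      ({p : ℕ × ℤ | p.1 = m}.piecewise φ θ) (m, j) = φ (m, j) := by
    intro φ j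
    simp [Set.piecewise]
  have hint : ∀ φ : ℕ × ℤ → α, G ({p : ℕ × ℤ | p.1 = m}.piecewise φ θ) *
      ∑ y, h y (({p : ℕ × ℤ | p.1 = m}.piecewise φ θ)
          (m, J ({p : ℕ × ℤ | p.1 = m}.piecewise φ θ))) *
        (∑' j, if j = J ({p : ℕ × ℤ | p.1 = m}.piecewise φ θ) then 0 else
          h y (({p : ℕ × ℤ | p.1 = m}.piecewise φ θ) (m, j)) *
            N ({p : ℕ × ℤ | p.1 = m}.piecewise φ θ) j) ^ ρ =
      G θ * ∑ y, h y (φ (m, J θ)) *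
        (∑' j, if j = J θ then 0 else h y (φ (m, j)) * N θ j) ^ ρ := by
    intro φ
    rw [hG' _ _ (hpw φ), hJ' _ _ (hpw φ), hN' _ _ (hpw φ)]
    simp_rw [hpm]
  simp_rw [hint]
  have hc : ∀ y, Measurable fun φ : ℕ × ℤ → α => h y (φ (m, J θ)) *
      (∑' j, if j = J θ then 0 else h y (φ (m, j)) * N θ j) ^ ρ := by
    intro y
    refine ((hh y).comp (measurable_pi_apply _)).mul ((Measurable.tsum fun j => ?_).pow_const ρ)
    split_ifs
    · exact measurable_const
    · exact ((hh y).comp (measurable_pi_apply _)).mul_const _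
  rw [lintegral_const_mul _ (Finset.measurable_fun_sum _ fun y _ => hc y),
    lintegral_finsetSum _ fun y _ => hc y, mul_left_comm, Finset.sum_mul]
  gcongr with y
  exact lintegral_competitors_le κ h0 h1 m (J θ) (N θ) (hh y)

/-! ### Gallager's function -/

theorem pmf_toReal_mem_stdSimplex {A : Type*} [Fintype A] (Q : PMF A) :
    (fun a => (Q a).toReal) ∈ stdSimplex ℝ A := by
  refine ⟨fun a => ENNReal.toReal_nonneg, ?_⟩
  rw [← ENNReal.toReal_sum fun a _ => Q.apply_ne_top a, ← tsum_fintype (L := .unconditional A),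
    Q.tsum_coe, ENNReal.toReal_one]

theorem gallagerSum_pos {A B : Type*} [Fintype A] [Fintype B] (P : A → PMF B) {q : A → ℝ}
    (hq : q ∈ stdSimplex ℝ A) {ρ : ℝ} :
    0 < ∑ b, (∑ a, q a * (P a b).toReal ^ (1 / (1 + ρ))) ^ (1 + ρ) := by
  have hterm : ∀ b a, 0 ≤ q a * (P a b).toReal ^ (1 / (1 + ρ)) := fun b a =>
    mul_nonneg (hq.1 a) (Real.rpow_nonneg ENNReal.toReal_nonneg _)
  obtain ⟨a, -, ha⟩ : ∃ a ∈ Finset.univ, 0 < q a := by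
    by_contra! h
    have := Finset.sum_nonpos h
    rw [hq.2] at this
    linarith
  obtain ⟨b, hb⟩ := (P a).support_nonempty
  refine Finset.sum_pos' (fun b _ => Real.rpow_nonneg (Finset.sum_nonneg fun a _ => hterm b a) _)
    ⟨b, Finset.mem_univ b, Real.rpow_pos_of_pos (Finset.sum_pos' (fun a _ => hterm b a)
      ⟨a, Finset.mem_univ a, mul_pos ha (Real.rpow_pos_of_pos ?_ _)⟩) _⟩
  exact ENNReal.toReal_pos ((P a).mem_support_iff b |>.1 hb) ((P a).apply_ne_top b)

/-- `E₀(ρ, Q) - ρ R` is jointly continuous in the input distribution and `ρ ∈ [0, 1]`. -/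
theorem continuousOn_gallager {A B : Type*} [Fintype A] [Fintype B] (P : A → PMF B) (R : ℝ) :
    ContinuousOn (fun z : (A → ℝ) × ℝ => -Real.logb 2
        (∑ b, (∑ a, z.1 a * (P a b).toReal ^ (1 / (1 + z.2))) ^ (1 + z.2)) - z.2 * R)
      (stdSimplex ℝ A ×ˢ Set.Icc 0 1) := by
  have hpos : ∀ z ∈ (stdSimplex ℝ A ×ˢ Set.Icc (0 : ℝ) 1), 0 < 1 + z.2 := by
    rintro z ⟨-, h0, -⟩; linarith
  have h1 : ContinuousOn (fun z : (A → ℝ) × ℝ => 1 + z.2) (stdSimplex ℝ A ×ˢ Set.Icc 0 1) := by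
    fun_prop
  refine ContinuousOn.sub (ContinuousOn.neg ?_) (by fun_prop)
  refine ContinuousOn.div_const (ContinuousOn.log ?_ fun z hz => (gallagerSum_pos P hz.1).ne') _
  refine continuousOn_finsetSum _ fun b _ => ContinuousOn.rpow ?_ h1 fun z hz => .inr (hpos z hz)
  refine continuousOn_finsetSum _ fun a _ => ContinuousOn.mul (by fun_prop) ?_
  exact ContinuousOn.rpow continuousOn_const
    (continuousOn_const.div h1 fun z hz => (hpos z hz).ne')
    fun z hz => .inr (one_div_pos.2 (hpos z hz))

theorem exists_isOptimalInput {A B : Type*} [Fintype A] [Fintype B] [Nonempty A] (P : A → PMF B)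
    (R : ℝ) : ∃ Q : PMF A, IsOptimalInput P R Q := by
  have hne : (stdSimplex ℝ A ×ˢ Set.Icc (0 : ℝ) 1).Nonempty :=
    (Set.nonempty_of_mem (pmf_toReal_mem_stdSimplex (PMF.pure (Classical.arbitrary A)))).prod
      ⟨0, by simp⟩
  obtain ⟨⟨q, ρ⟩, hz, hmax⟩ := ((isCompact_stdSimplex ℝ A).prod isCompact_Icc).exists_isMaxOn hne
    (continuousOn_gallager P R)
  have hle : ∀ Q : PMF A, ∀ ρ' ∈ Set.Icc (0 : ℝ) 1, gallagerE0 P Q ρ' - ρ' * R ≤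
      -Real.logb 2 (∑ b, (∑ a, q a * (P a b).toReal ^ (1 / (1 + ρ))) ^ (1 + ρ)) - ρ * R :=
    fun Q ρ' hρ' => hmax (a := (fun a => (Q a).toReal, ρ')) ⟨pmf_toReal_mem_stdSimplex Q, hρ'⟩
  have hsum : ∑ a, ENNReal.ofReal (q a) = 1 := by
    rw [← ENNReal.ofReal_sum_of_nonneg fun a _ => hz.1.1 a, hz.1.2, ENNReal.ofReal_one]
  refine ⟨PMF.ofFintype (fun a => ENNReal.ofReal (q a)) hsum, fun Q' => ?_⟩
  refine csSup_le (Set.Nonempty.image _ ⟨0, by simp⟩) ?_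
  rintro _ ⟨ρ', hρ', rfl⟩
  refine (hle Q' ρ' hρ').trans (le_csSup ⟨-Real.logb 2
    (∑ b, (∑ a, q a * (P a b).toReal ^ (1 / (1 + ρ))) ^ (1 + ρ)) - ρ * R, ?_⟩ ⟨ρ, hz.2, ?_⟩)
  · rintro _ ⟨ρ'', hρ'', rfl⟩
    exact hle _ ρ'' hρ''
  · simp only [gallagerE0, PMF.ofFintype_apply, ENNReal.toReal_ofReal (hz.1.1 _)]

/-- An optimal input has `E₀(ρ, Q) - ρ R` above any number below the random coding exponent, for
a suitable `ρ`. -/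
theorem IsOptimalInput.exists_lt_gallagerE0 {A B : Type*} [Fintype A] [Fintype B] {P : A → PMF B}
    {R x : ℝ} {Q : PMF A} (hQ : IsOptimalInput P R Q) (hx : x < randomCodingExponent P R) :
    ∃ ρ ∈ Set.Icc (0 : ℝ) 1, x < gallagerE0 P Q ρ - ρ * R := by
  have : Nonempty (PMF A) := ⟨Q⟩
  have h : x < randomCodingExponentAt P R Q := hx.trans_le (ciSup_le hQ)
  obtain ⟨_, ⟨ρ, hρ, rfl⟩, h⟩ := exists_lt_of_lt_csSup (Set.Nonempty.image _ ⟨0, by simp⟩) h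
  exact ⟨ρ, hρ, h⟩

/-- The probability of the output word `y` given the input word `a`. -/
noncomputable def wordProb {A B : Type*} (P : A → PMF B) {n : ℕ} (a : Fin n → A)
    (y : Fin n → B) : ℝ≥0∞ := ∏ m, P (a m) (y m)

theorem wordProb_ne_top {A B : Type*} (P : A → PMF B) {n : ℕ} (a : Fin n → A) (y : Fin n → B) :
    wordProb P a y ≠ ∞ :=
  ENNReal.prod_ne_top fun m _ => (P (a m)).apply_ne_top (y m)

theorem sum_wordProb {A B : Type*} [Fintype B] (P : A → PMF B) {n : ℕ} (a : Fin n → A) :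
    ∑ y : Fin n → B, wordProb P a y = 1 := by
  classical
  simp only [wordProb]
  rw [← Fintype.piFinset_univ, ← Finset.prod_univ_sum (fun _ => Finset.univ) fun m b => P (a m) b]
  refine Finset.prod_eq_one fun m _ => ?_
  rw [← tsum_fintype (L := .unconditional B), (P (a m)).tsum_coe]

/-- Gallager's sum factorizes over the letters of a word. -/
theorem sum_lintegral_wordProb_rpow {A B : Type*} [Fintype A] [Fintype B] [MeasurableSpace A]
    [DiscreteMeasurableSpace A] (P : A → PMF B) (Q : PMF A) {s ρ : ℝ} (hs : 0 ≤ s) (hρ : 0 ≤ ρ)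
    (n : ℕ) :
    ∑ y : Fin n → B, (∫⁻ a, wordProb P a y ^ s ∂(Measure.pi fun _ => Q.toMeasure)) ^ (1 + ρ) =
      (∑ b, (∑ a, Q a * P a b ^ s) ^ (1 + ρ)) ^ n := by
  classical
  have h : ∀ y : Fin n → B, ∫⁻ a, wordProb P a y ^ s ∂(Measure.pi fun _ => Q.toMeasure) =
      ∏ m, ∑ a, Q a * P a (y m) ^ s := by
    intro y
    rw [lintegral_fintype, Finset.prod_univ_sum, Fintype.piFinset_univ]
    refine Finset.sum_congr rfl fun a _ => ?_
    rw [Measure.pi_singleton, wordProb, ← ENNReal.prod_rpow_of_nonneg hs,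
      ← Finset.prod_mul_distrib]
    refine Finset.prod_congr rfl fun m _ => ?_
    rw [Q.toMeasure_apply_singleton _ (measurableSet_singleton _), mul_comm]
  have h' : ∀ y : Fin n → B, (∏ m, ∑ a, Q a * P a (y m) ^ s) ^ (1 + ρ) =
      ∏ m, (∑ a, Q a * P a (y m) ^ s) ^ (1 + ρ) := fun y =>
    (ENNReal.prod_rpow_of_nonneg (by linarith)).symm
  simp_rw [h, h']
  rw [← Fintype.piFinset_univ, ← Finset.prod_univ_sum (fun _ => Finset.univ)
    (fun _ b => (∑ a, Q a * P a b ^ s) ^ (1 + ρ)), Finset.prod_const, Finset.card_univ,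
    Fintype.card_fin]

theorem sum_rpow_eq_ofReal_two_rpow {A B : Type*} [Fintype A] [Fintype B] (P : A → PMF B)
    (Q : PMF A) {ρ : ℝ} (hρ : 0 ≤ ρ) :
    ∑ b, (∑ a, Q a * P a b ^ (1 / (1 + ρ))) ^ (1 + ρ) =
      ENNReal.ofReal (2 ^ (-gallagerE0 P Q ρ)) := by
  have h1 : 0 ≤ 1 / (1 + ρ) := by positivity
  have hterm : ∀ b a, 0 ≤ (Q a).toReal * (P a b).toReal ^ (1 / (1 + ρ)) := fun b a => by
    positivity
  rw [gallagerE0, neg_neg, Real.rpow_logb two_pos (by norm_num)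
    (gallagerSum_pos P (pmf_toReal_mem_stdSimplex Q)),
    ENNReal.ofReal_sum_of_nonneg fun b _ =>
      Real.rpow_nonneg (Finset.sum_nonneg fun a _ => hterm b a) _]
  refine Finset.sum_congr rfl fun b _ => ?_
  rw [← ENNReal.ofReal_rpow_of_nonneg (Finset.sum_nonneg fun a _ => hterm b a) (by linarith),
    ENNReal.ofReal_sum_of_nonneg fun a _ => hterm b a]
  congr 1
  refine Finset.sum_congr rfl fun a _ => ?_
  rw [ENNReal.ofReal_mul ENNReal.toReal_nonneg, ENNReal.ofReal_toReal (Q.apply_ne_top a),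
    ← ENNReal.ofReal_rpow_of_nonneg ENNReal.toReal_nonneg h1,
    ENNReal.ofReal_toReal ((P a).apply_ne_top b)]

/-! ### A causal maximum-likelihood controller -/

/-- The infinite output sequence that starts with `b₀, …, b_{T-1}` and continues with an arbitrary
constant. -/
noncomputable def extendSeq {B : Type*} [Nonempty B] {T : ℕ} (b : Fin T → B) (t : ℕ) : B :=
  if h : t < T then b ⟨t, h⟩ else Classical.arbitrary B

theorem extendSeq_apply {B : Type*} [Nonempty B] {T : ℕ} (b : Fin T → B) {t : ℕ} (h : t < T) :
    extendSeq b t = b ⟨t, h⟩ := dif_pos h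

/-- The controls that cancel the motion of the centers of the bins `s₀, s₁, …` chosen at the ends
of the successive stages. -/
noncomputable def binControl (lam Δ : ℝ) (n : ℕ) (s : List ℤ) (t : ℕ) : ℝ :=
  if n ∣ t + 1 then -lam ^ n * binCenter Δ (s.getD (t / n) 0) else 0

/-- For given bins of the past, a maximum-likelihood path can be selected as a measurable function
of the labels of the stages so far: only finitely many labels matter, because the trellis is
finite. -/
theorem exists_mlSelection {A B : Type*} [Finite A] [MeasurableSpace A]
    [DiscreteMeasurableSpace A] (P : A → PMF B) {lam Ω Δ : ℝ} {n : ℕ} (hlam : 0 ≤ lam)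
    (hΩ : 0 ≤ Ω) (hΔ : 0 < Δ) (hn : 0 < n) (s : List ℤ) (k : ℕ) (b : Fin ((k + 1) * n) → B) :
    ∃ sel : Labels n A → Fin (k + 1) → ℤ,
      (∀ θ, IsMLPath P lam Ω Δ n θ (binControl lam Δ n s) k b (sel θ)) ∧ Measurable sel ∧
        ∀ θ θ' : Labels n A, (∀ i ≤ k, ∀ j, θ (i, j) = θ' (i, j)) → sel θ = sel θ' := by
  let S := {p // IsTrellisPath lam Ω Δ n (binControl lam Δ n s) k p}
  have hfin : Finite S := (finite_setOf_isTrellisPath (Ω := Ω) hlam hΔ hn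
    (u := binControl lam Δ n s) (fun t ht => if_neg ht) k).to_subtype
  have hne : Nonempty S := ⟨⟨_, isTrellisPath_quantize (Γ := 0) (w := 0) (ν := 0) hΔ
    (by linarith) (fun _ => by simpa using div_nonneg hΩ zero_le_two) (fun _ => by simp) k⟩⟩
  have hmax : ∀ g : S → Fin (k + 1) → Fin n → A, ∃ p, ∀ q,
      (∏ i, ∏ m, P (g q i m) (b (finProdFinEquiv (i, m)))) ≤
        ∏ i, ∏ m, P (g p i m) (b (finProdFinEquiv (i, m))) := fun g =>
    Finite.exists_max _
  choose f hf using hmax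
  refine ⟨fun θ => (f fun p i => θ (i, p.1 i)).1, fun θ => ⟨(f _).2, fun q hq => ?_⟩, ?_, ?_⟩
  · exact hf (fun p i => θ (i, p.1 i)) ⟨q, hq⟩
  · have h1 : Measurable fun g : S → Fin (k + 1) → Fin n → A => (f g).1 := .of_discrete
    refine h1.comp (g := fun g : S → Fin (k + 1) → Fin n → A => (f g).1)
      (f := fun θ : Labels n A => fun (p : S) (i : Fin (k + 1)) => θ (i, p.1 i)) ?_
    exact measurable_pi_lambda _ fun p => measurable_pi_lambda _ fun i => measurable_pi_apply _
  · intro θ θ' h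
    have : (fun (p : S) (i : Fin (k + 1)) => θ (i, p.1 i)) =
        fun (p : S) (i : Fin (k + 1)) => θ' (i, p.1 i) := by
      funext p i
      exact h i (Nat.le_of_lt_succ i.isLt) _
    simp only [this]

/-- The last bins of the paths selected at the ends of the stages `0, …, k - 1`. -/
def selectedBins {A B : Type*} {n : ℕ}
    (sel : List ℤ → (k : ℕ) → (Fin ((k + 1) * n) → B) → Labels n A → Fin (k + 1) → ℤ)
    (θ : Labels n A) (β : ℕ → B) : ℕ → List ℤ
  | 0 => []
  | k + 1 => selectedBins sel θ β k ++
      [sel (selectedBins sel θ β k) k (fun i => β i) θ (Fin.last k)]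

section
variable {A B : Type*} {n : ℕ}
  {sel : List ℤ → (k : ℕ) → (Fin ((k + 1) * n) → B) → Labels n A → Fin (k + 1) → ℤ}

theorem length_selectedBins (θ : Labels n A) (β : ℕ → B) (k : ℕ) :
    (selectedBins sel θ β k).length = k := by
  induction k with
  | zero => rfl
  | succ k ih => simp [selectedBins, ih]

theorem getD_selectedBins (θ : Labels n A) (β : ℕ → B) {i k : ℕ} (h : i < k) :
    (selectedBins sel θ β k).getD i 0 =
      sel (selectedBins sel θ β i) i (fun i => β i) θ (Fin.last i) := by
  induction k with
  | zero => omega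
  | succ k ih =>
    rcases Nat.lt_succ_iff_lt_or_eq.1 h with h | rfl
    · rw [selectedBins, List.getD_append _ _ _ _ (by rwa [length_selectedBins]), ih h]
    · rw [selectedBins, List.getD_append_right _ _ _ _ (by rw [length_selectedBins]),
        length_selectedBins]
      simp

theorem selectedBins_congr_outputs (θ : Labels n A) {β β' : ℕ → B} {k : ℕ}
    (h : ∀ t < k * n, β t = β' t) : selectedBins sel θ β k = selectedBins sel θ β' k := by
  induction k with
  | zero => rfl
  | succ k ih =>
    rw [selectedBins, selectedBins, ih fun t ht => h t (by linarith)]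
    have : (fun i : Fin ((k + 1) * n) => β i) = fun i : Fin ((k + 1) * n) => β' i :=
      funext fun i => h i i.isLt
    rw [this]

theorem selectedBins_congr_labels {θ θ' : Labels n A} (β : ℕ → B) {k : ℕ}
    (hsel : ∀ s k b, ∀ θ θ' : Labels n A,
      (∀ i ≤ k, ∀ j, θ (i, j) = θ' (i, j)) → sel s k b θ = sel s k b θ')
    (h : ∀ i < k, ∀ j, θ (i, j) = θ' (i, j)) :
    selectedBins sel θ β k = selectedBins sel θ' β k := by
  induction k with
  | zero => rfl
  | succ k ih =>
    rw [selectedBins, selectedBins, ih fun i hi => h i (by omega),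
      hsel _ _ _ θ θ' fun i hi => h i (by omega)]

theorem measurableSet_selectedBins_eq [MeasurableSpace A]
    (hsel : ∀ s k b, Measurable (sel s k b)) (β : ℕ → B) (k : ℕ) (s : List ℤ) :
    MeasurableSet {θ | selectedBins sel θ β k = s} := by
  induction k generalizing s with
  | zero => simp [selectedBins]
  | succ k ih =>
    have : {θ | selectedBins sel θ β (k + 1) = s} =
        ⋃ s' : List ℤ, {θ | selectedBins sel θ β k = s'} ∩
          {θ | s' ++ [sel s' k (fun i => β i) θ (Fin.last k)] = s} := by
      ext θ; simp [selectedBins]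
    rw [this]
    refine .iUnion fun s' => (ih s').inter ?_
    have hm : Measurable fun θ => sel s' k (fun i => β i) θ (Fin.last k) :=
      (measurable_pi_apply _).comp (hsel s' k _)
    exact hm (MeasurableSet.of_discrete (s := {j : ℤ | s' ++ [j] = s}))

end

/-- Some maximum-likelihood trellis-search controller breaks ties without looking at the labels of
later stages. (An arbitrary one might, and would then leak future labels into the state.) -/
theorem exists_causal_isMLTrellisController {A B : Type*} [Finite A] [Nonempty B]
    [MeasurableSpace A] [DiscreteMeasurableSpace A] (P : A → PMF B) {lam Ω Δ : ℝ} {n : ℕ}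
    (hlam : 0 ≤ lam) (hΩ : 0 ≤ Ω) (hΔ : 0 < Δ) (hn : 0 < n) :
    ∃ C : Controller (Labels n A) B, IsMLTrellisController P lam Ω Δ n C ∧
      ∀ t (θ θ' : Labels n A) b, (∀ i ≤ t / n, ∀ j, θ (i, j) = θ' (i, j)) →
        C.act t θ b = C.act t θ' b := by
  choose sel hML hmeas hcausal using fun s k (b : Fin ((k + 1) * n) → B) =>
    exists_mlSelection (Ω := Ω) P hlam hΩ hΔ hn s k b
  let C : Controller (Labels n A) B :=
    { act := fun t θ b => binControl lam Δ n (selectedBins sel θ (extendSeq b) (t / n + 1)) t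
      measurable_act := by
        intro t b U _
        have : (fun θ => binControl lam Δ n (selectedBins sel θ (extendSeq b) (t / n + 1)) t) ⁻¹' U
            = ⋃ s ∈ {s | binControl lam Δ n s t ∈ U},
              {θ | selectedBins sel θ (extendSeq b) (t / n + 1) = s} := by
          ext θ; simp
        rw [this]
        exact .biUnion (Set.to_countable _) fun s _ => measurableSet_selectedBins_eq hmeas _ _ s }
  have hidx : ∀ k, ((k + 1) * n - 1) + 1 = (k + 1) * n := fun k =>
    Nat.sub_add_cancel (Nat.mul_pos k.succ_pos hn)
  have hdiv : ∀ t q, t + 1 = (q + 1) * n → t / n = q := by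
    intro t q h
    have h' : t = n - 1 + q * n := by rw [add_mul] at h; omega
    rw [h', Nat.add_mul_div_right _ _ hn, Nat.div_eq_of_lt (by omega), zero_add]
  refine ⟨C, ⟨fun t θ b ht => if_neg ht, fun θ k b => ?_⟩, ?_⟩
  · have hb : (fun i : Fin ((k + 1) * n) => extendSeq b i) = b :=
      funext fun i => extendSeq_apply b i.isLt
    -- An earlier control only uses a prefix of the outputs, which does not change its value.
    have hctl : ∀ t q, q ≤ k → t + 1 = (q + 1) * n → controls C θ b t = -lam ^ n * binCenter Δ
        (sel (selectedBins sel θ (extendSeq b) q) q (fun i => extendSeq b i) θ (Fin.last q)) := by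
      intro t q hq ht
      have hle : (q + 1) * n ≤ (k + 1) * n := Nat.mul_le_mul_right n (by omega)
      have htT : t < (k + 1) * n := by omega
      have hpre : ∀ r < (q + 1) * n,
          extendSeq (fun i : Fin (t + 1) => b (Fin.castLE htT i)) r = extendSeq b r := by
        intro r hr
        rw [extendSeq_apply _ (ht ▸ hr), extendSeq_apply _ (hr.trans_le hle)]
        rfl
      have hpre' : (fun i : Fin ((q + 1) * n) =>
          extendSeq (fun i : Fin (t + 1) => b (Fin.castLE htT i)) i) =
          fun i : Fin ((q + 1) * n) => extendSeq b i := funext fun i => hpre i i.isLt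
      rw [controls, dif_pos htT]
      change binControl lam Δ n (selectedBins sel θ _ (t / n + 1)) t = _
      rw [binControl, if_pos ⟨q + 1, by rw [ht, mul_comm]⟩, hdiv t q ht,
        getD_selectedBins θ _ q.lt_succ_self, hpre',
        selectedBins_congr_outputs θ fun r hr => hpre r (by linarith)]
    have hpast : ∀ t < k * n, binControl lam Δ n (selectedBins sel θ (extendSeq b) k) t =
        controls C θ b t := by
      intro t ht
      by_cases hd : n ∣ t + 1
      · obtain ⟨q', hq'⟩ := hd
        obtain ⟨q, rfl⟩ : ∃ q, q' = q + 1 :=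
          Nat.exists_eq_succ_of_ne_zero (by rintro rfl; omega)
        rw [mul_comm] at hq'
        have hqk : q < k := by
          have : (q + 1) * n ≤ k * n := by omega
          exact Nat.le_of_mul_le_mul_right this hn
        rw [hctl t q hqk.le hq', binControl, if_pos ⟨q + 1, by rw [hq', mul_comm]⟩,
          hdiv t q hq', getD_selectedBins θ _ hqk]
      · rw [binControl, if_neg hd, controls, dif_pos (by linarith)]
        exact (if_neg hd).symm
    have h := hML (selectedBins sel θ (extendSeq b) k) k b θ
    refine ⟨sel (selectedBins sel θ (extendSeq b) k) k b θ, ⟨h.1.congr hpast, fun q hq =>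
      h.2 q (hq.congr fun t ht => (hpast t ht).symm)⟩, ?_⟩
    rw [hctl _ k le_rfl (hidx k), hb]
  · intro t θ θ' b h
    change binControl lam Δ n (selectedBins sel θ _ (t / n + 1)) t =
      binControl lam Δ n (selectedBins sel θ' _ (t / n + 1)) t
    rw [selectedBins_congr_labels _ hcausal fun i hi => h i (by omega)]

/-! ### Sums over output sequences -/

/-- The sum of `g` over all output words of length `T`, extended to infinite sequences. -/
noncomputable def sumOutputs {B : Type*} [Fintype B] [Nonempty B] (T : ℕ)
    (g : (ℕ → B) → ℝ≥0∞) : ℝ≥0∞ := ∑ b : Fin T → B, g (extendSeq b)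

/-- The sequence that agrees with `β` before time `T` and continues with the word `y`. -/
noncomputable def splice {B : Type*} [Nonempty B] {n : ℕ} (T : ℕ) (β : ℕ → B) (y : Fin n → B)
    (t : ℕ) : B := if t < T then β t else extendSeq y (t - T)

theorem splice_of_lt {B : Type*} [Nonempty B] {n T t : ℕ} {β : ℕ → B} {y : Fin n → B}
    (h : t < T) : splice T β y t = β t := if_pos h

theorem splice_add {B : Type*} [Nonempty B] {n T : ℕ} {β : ℕ → B} {y : Fin n → B} (m : Fin n) :
    splice T β y (T + m) = y m := by
  rw [splice, if_neg (by omega), Nat.add_sub_cancel_left, extendSeq_apply _ m.isLt]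

theorem sumOutputs_add {B : Type*} [Fintype B] [Nonempty B] (T n : ℕ) (g : (ℕ → B) → ℝ≥0∞) :
    sumOutputs (T + n) g = sumOutputs T fun β => ∑ y : Fin n → B, g (splice T β y) := by
  have h : ∀ (b : Fin T → B) (y : Fin n → B),
      extendSeq (Fin.append b y) = splice T (extendSeq b) y := by
    intro b y
    funext t
    rcases lt_or_ge t T with ht | ht
    · rw [splice_of_lt ht, extendSeq_apply _ ht, extendSeq_apply _ (by omega : t < T + n)]
      exact Fin.append_left b y ⟨t, ht⟩
    · obtain ⟨m, rfl⟩ := Nat.exists_eq_add_of_le ht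
      by_cases hm : m < n
      · rw [splice_add ⟨m, hm⟩, extendSeq_apply _ (by omega : T + m < T + n)]
        exact Fin.append_right b y ⟨m, hm⟩
      · rw [splice, if_neg (by omega), Nat.add_sub_cancel_left, extendSeq, dif_neg (by omega),
          extendSeq, dif_neg hm]
  rw [sumOutputs, sumOutputs, ← (Fin.appendEquiv T n).sum_comp, Fintype.sum_prod_type]
  exact Finset.sum_congr rfl fun b _ => Finset.sum_congr rfl fun y _ => congrArg g (h b y)

theorem sumOutputs_mono {B : Type*} [Fintype B] [Nonempty B] {T : ℕ} {g g' : (ℕ → B) → ℝ≥0∞}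
    (h : ∀ b : Fin T → B, g (extendSeq b) ≤ g' (extendSeq b)) :
    sumOutputs T g ≤ sumOutputs T g' := Finset.sum_le_sum fun b _ => h b

theorem lintegral_sumOutputs {Θ B : Type*} [MeasurableSpace Θ] [Fintype B] [Nonempty B]
    (μ : Measure Θ) (T : ℕ) {F : Θ → (ℕ → B) → ℝ≥0∞} (hF : ∀ β, Measurable fun θ => F θ β) :
    ∫⁻ θ, sumOutputs T (F θ) ∂μ = ∑ b : Fin T → B, ∫⁻ θ, F θ (extendSeq b) ∂μ :=
  lintegral_finsetSum _ fun b _ => hF (extendSeq b)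

/-! ### Labels and outputs of the past -/

/-- The labels and the outputs agree in the stages before `m`. -/
def AgreeBefore {A B : Type*} {n : ℕ} (m : ℕ) (θ θ' : Labels n A) (β β' : ℕ → B) : Prop :=
  (∀ i < m, ∀ j, θ (i, j) = θ' (i, j)) ∧ ∀ t < m * n, β t = β' t

theorem AgreeBefore.mono {A B : Type*} {n m m' : ℕ} {θ θ' : Labels n A} {β β' : ℕ → B}
    (h : AgreeBefore m θ θ' β β') (hm : m' ≤ m) : AgreeBefore m' θ θ' β β' :=
  ⟨fun i hi => h.1 i (hi.trans_le hm),
    fun t ht => h.2 t (ht.trans_le (Nat.mul_le_mul_right n hm))⟩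

theorem agreeBefore_splice {A B : Type*} {n : ℕ} (θ : Labels n A) (β : ℕ → B) [Nonempty B]
    (m : ℕ) (y : Fin n → B) : AgreeBefore m θ θ (splice (m * n) β y) β :=
  ⟨fun _ _ _ => rfl, fun _ ht => splice_of_lt ht⟩

/-! ### The closed loop as a function of the labels and the outputs -/

/-- The data of a closed loop with the randomly labeled lattice observer: the channel `P`, the plant
gain `lam`, the disturbance bound `Ω`, the bin width `Δ`, the controller `C`, the disturbances `w`
and the observation noise `ν`. -/
structure Loop (A B : Type*) [MeasurableSpace A] (n : ℕ) where
  P : A → PMF B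
  lam : ℝ
  Ω : ℝ
  Δ : ℝ
  C : Controller (Labels n A) B
  w : ℕ → ℝ
  ν : ℕ → ℝ

namespace Loop

variable {A B : Type*} [MeasurableSpace A] {n : ℕ} (L : Loop A B n)

/-- The control at time `t`. -/
noncomputable def control (θ : Labels n A) (β : ℕ → B) (t : ℕ) : ℝ :=
  L.C.act t θ fun i => β i

/-- The state at time `t`. -/
noncomputable def state (θ : Labels n A) (β : ℕ → B) (t : ℕ) : ℝ :=
  plantState L.lam 0 (L.control θ β) L.w t

/-- The bin whose label is sent in stage `k`. -/
noncomputable def trueBin (θ : Labels n A) (β : ℕ → B) (k : ℕ) : ℤ :=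
  quantize L.Δ (L.state θ β (k * n) + L.ν (k * n))

/-- The likelihood of bin `j` given the outputs of stage `k`. -/
noncomputable def binProb (θ : Labels n A) (β : ℕ → B) (k : ℕ) (j : ℤ) : ℝ≥0∞ :=
  wordProb L.P (θ (k, j)) fun m => β (k * n + m)

/-- The conditional probability of the outputs of stage `k`. -/
noncomputable def stageProb (θ : Labels n A) (β : ℕ → B) (k : ℕ) : ℝ≥0∞ :=
  L.binProb θ β k (L.trueBin θ β k)

/-- The necessary condition of `IsTrellisEdge.abs_binCenter_sub_le` for an edge from bin `j` in
stage `k` to bin `j'` in stage `k + 1`, as a `0`-`1` weight. -/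
noncomputable def edgeWeight (θ : Labels n A) (β : ℕ → B) (k : ℕ) (j j' : ℤ) : ℝ≥0∞ :=
  if |binCenter L.Δ j' - (L.lam ^ n * binCenter L.Δ j + L.control θ β (k * n + (n - 1)))| ≤
    edgeRadius L.lam L.Ω L.Δ n then 1 else 0

/-- The `0`-`1` weight of the bins in stage `i` that a path can reach if it agrees with the true
path in stage `i - 1`; in stage `0`, of the bins near the initial state `0`. -/
noncomputable def startWeight (θ : Labels n A) (β : ℕ → B) : ℕ → ℤ → ℝ≥0∞
  | 0, j => if |binCenter L.Δ j - 0| ≤ edgeRadius L.lam L.Ω L.Δ n then 1 else 0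
  | i + 1, j => L.edgeWeight θ β i (L.trueBin θ β i) j

open Classical in
/-- The sum of the `s`-th powers of the likelihoods over stages `i, …, i + d - 1` of the paths that
leave the true path before stage `i`, avoid it in these stages, and are in bin `j` in stage
`i + d`. -/
noncomputable def pathWeight (s : ℝ) (θ : Labels n A) (β : ℕ → B) (i : ℕ) : ℕ → ℤ → ℝ≥0∞
  | 0, j => L.startWeight θ β i j
  | d + 1, j' => ∑' j, L.edgeWeight θ β (i + d) j j' *
      if j = L.trueBin θ β (i + d) then 0 else
        L.binProb θ β (i + d) j ^ s * pathWeight s θ β i d j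

open Classical in
/-- The sum of the `s`-th powers of the likelihoods over stages `i, …, i + d` of the paths that
leave the true path before stage `i` and avoid it in these stages. -/
noncomputable def rivalWeight (s : ℝ) (θ : Labels n A) (β : ℕ → B) (i d : ℕ) : ℝ≥0∞ :=
  ∑' j, if j = L.trueBin θ β (i + d) then 0 else
    L.binProb θ β (i + d) j ^ s * L.pathWeight s θ β i d j

/-- The probability of the outputs of stages `0, …, i - 1` times the `s`-th power of that of the
outputs of stages `i, …, i + d - 1`. -/
noncomputable def tiltedProb (s : ℝ) (θ : Labels n A) (β : ℕ → B) (i d : ℕ) : ℝ≥0∞ :=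
  (∏ k ∈ Finset.range i, L.stageProb θ β k) *
    ∏ e ∈ Finset.range d, L.stageProb θ β (i + e) ^ s

/-! ### Causality -/

/-- The controller does not use labels of later stages. -/
def IsCausal : Prop :=
  ∀ t (θ θ' : Labels n A) b, (∀ i ≤ t / n, ∀ j, θ (i, j) = θ' (i, j)) →
    L.C.act t θ b = L.C.act t θ' b

variable {L} {m : ℕ} {θ θ' : Labels n A} {β β' : ℕ → B}

theorem control_congr (hC : L.IsCausal) (h : AgreeBefore m θ θ' β β') {t : ℕ} (ht : t < m * n) :
    L.control θ β t = L.control θ' β' t := by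
  have hn : 0 < n := Nat.pos_of_ne_zero (by rintro rfl; simp at ht)
  have hb : (fun i : Fin (t + 1) => β i) = fun i : Fin (t + 1) => β' i :=
    funext fun i => h.2 i (by have := i.isLt; omega)
  rw [control, control, hb]
  exact hC t θ θ' _ fun i hi => h.1 i (hi.trans_lt ((Nat.div_lt_iff_lt_mul hn).2 ht))

theorem trueBin_congr (hC : L.IsCausal) (h : AgreeBefore m θ θ' β β') :
    L.trueBin θ β m = L.trueBin θ' β' m := by
  rw [trueBin, trueBin, state, state, plantState_congr fun s hs => control_congr hC h hs]

theorem binProb_congr (h : AgreeBefore (m + 1) θ θ' β β') (j : ℤ) :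
    L.binProb θ β m j = L.binProb θ' β' m j := by
  rw [binProb, binProb, h.1 m m.lt_succ_self]
  congr 1
  funext i
  exact h.2 _ (by have := i.isLt; rw [add_mul]; omega)

theorem stageProb_congr (hC : L.IsCausal) (h : AgreeBefore (m + 1) θ θ' β β') :
    L.stageProb θ β m = L.stageProb θ' β' m := by
  rw [stageProb, stageProb, trueBin_congr hC (h.mono m.le_succ), binProb_congr h]

theorem edgeWeight_congr (hC : L.IsCausal) (hn : 0 < n) (h : AgreeBefore (m + 1) θ θ' β β')
    (j j' : ℤ) : L.edgeWeight θ β m j j' = L.edgeWeight θ' β' m j j' := by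
  rw [edgeWeight, edgeWeight, control_congr hC h (by rw [add_mul]; omega)]

theorem startWeight_congr (hC : L.IsCausal) (hn : 0 < n) {i : ℕ} (h : AgreeBefore i θ θ' β β') :
    L.startWeight θ β i = L.startWeight θ' β' i := by
  funext j
  cases i with
  | zero => rfl
  | succ i =>
    rw [startWeight, startWeight, trueBin_congr hC (h.mono i.le_succ), edgeWeight_congr hC hn h]

theorem pathWeight_congr (hC : L.IsCausal) (hn : 0 < n) (s : ℝ) {i d : ℕ}
    (h : AgreeBefore (i + d) θ θ' β β') :
    L.pathWeight s θ β i d = L.pathWeight s θ' β' i d := by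
  induction d with
  | zero => funext j; rw [pathWeight, pathWeight, startWeight_congr hC hn (i := i) h]
  | succ d ih =>
    have h' := h.mono (i + d).le_succ
    funext j'
    rw [pathWeight, pathWeight]
    refine tsum_congr fun j => ?_
    rw [edgeWeight_congr hC hn (m := i + d) h, trueBin_congr hC h', binProb_congr (m := i + d) h,
      ih h']

theorem tiltedProb_congr (hC : L.IsCausal) (s : ℝ) {i d : ℕ}
    (h : AgreeBefore (i + d) θ θ' β β') :
    L.tiltedProb s θ β i d = L.tiltedProb s θ' β' i d := by
  rw [tiltedProb, tiltedProb]
  congr 1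
  · refine Finset.prod_congr rfl fun k hk => ?_
    have := Finset.mem_range.1 hk
    exact stageProb_congr hC (h.mono (by omega))
  · refine Finset.prod_congr rfl fun k hk => ?_
    have := Finset.mem_range.1 hk
    rw [stageProb_congr hC (h.mono (by omega))]

/-! ### Measurability in the labels -/

variable (L)

theorem measurable_control (β : ℕ → B) (t : ℕ) : Measurable fun θ => L.control θ β t :=
  L.C.measurable_act t _

theorem measurable_state (β : ℕ → B) (t : ℕ) : Measurable fun θ => L.state θ β t := by
  induction t with
  | zero => exact measurable_const
  | succ t ih => exact ((ih.const_mul L.lam).add (L.measurable_control β t)).add_const _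

theorem measurable_trueBin (β : ℕ → B) (k : ℕ) : Measurable fun θ => L.trueBin θ β k :=
  (measurable_quantize L.Δ).comp ((L.measurable_state β _).add_const _)

theorem measurable_edgeWeight (β : ℕ → B) (k : ℕ) {f : Labels n A → ℤ} (hf : Measurable f)
    (j' : ℤ) : Measurable fun θ => L.edgeWeight θ β k (f θ) j' := by
  have hc : Measurable fun θ => binCenter L.Δ (f θ) :=
    (measurable_of_countable (binCenter L.Δ)).comp hf
  have hu := L.measurable_control β (k * n + (n - 1))
  refine Measurable.ite (measurableSet_le ?_ measurable_const) measurable_const measurable_const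
  fun_prop

variable [Finite A] [DiscreteMeasurableSpace A]

theorem measurable_binProb (β : ℕ → B) (k : ℕ) {f : Labels n A → ℤ} (hf : Measurable f) :
    Measurable fun θ => L.binProb θ β k (f θ) := by
  have h : Measurable fun q : Labels n A × ℤ => L.binProb q.1 β k q.2 :=
    measurable_from_prod_countable_left fun j =>
      (Measurable.of_discrete
        (f := fun a : Fin n → A => wordProb L.P a fun m => β (k * n + m))).comp
        (measurable_pi_apply (k, j))
  exact h.comp (measurable_id.prodMk hf)

theorem measurable_stageProb (β : ℕ → B) (k : ℕ) : Measurable fun θ => L.stageProb θ β k :=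
  L.measurable_binProb β k (L.measurable_trueBin β k)

theorem measurable_pathWeight (s : ℝ) (β : ℕ → B) (i d : ℕ) (j : ℤ) :
    Measurable fun θ => L.pathWeight s θ β i d j := by
  induction d generalizing j with
  | zero =>
    cases i with
    | zero => exact measurable_const
    | succ i => exact L.measurable_edgeWeight β i (L.measurable_trueBin β i) j
  | succ d ih =>
    refine Measurable.tsum fun j' => (L.measurable_edgeWeight β _ measurable_const j).mul ?_
    exact Measurable.ite (measurableSet_eq_fun measurable_const (L.measurable_trueBin β _))
      measurable_const (((L.measurable_binProb β _ measurable_const).pow_const s).mul (ih j'))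

theorem measurable_rivalWeight (s : ℝ) (β : ℕ → B) (i d : ℕ) :
    Measurable fun θ => L.rivalWeight s θ β i d :=
  Measurable.tsum fun j => Measurable.ite
    (measurableSet_eq_fun measurable_const (L.measurable_trueBin β _)) measurable_const
    (((L.measurable_binProb β _ measurable_const).pow_const s).mul
      (L.measurable_pathWeight s β i d j))

theorem measurable_tiltedProb (s : ℝ) (β : ℕ → B) (i d : ℕ) :
    Measurable fun θ => L.tiltedProb s θ β i d :=
  (Finset.measurable_fun_prod _ fun k _ => L.measurable_stageProb β k).mul
    (Finset.measurable_fun_prod _ fun e _ => (L.measurable_stageProb β (i + e)).pow_const s)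

end Loop

namespace Loop

/-! ### The exponential bound on the weight of the rival paths -/

section
variable {A B : Type*} [MeasurableSpace A] {n : ℕ} (L : Loop A B n)

/-- The bound on the number of bins that an edge of the trellis can lead to. -/
noncomputable def branching : ℝ≥0∞ :=
  ENNReal.ofReal (4 * edgeRadius L.lam L.Ω L.Δ n / L.Δ + 1)

variable {L}

theorem tsum_edgeWeight_le (hΔ : 0 < L.Δ) (hr : 0 ≤ edgeRadius L.lam L.Ω L.Δ n)
    (θ : Labels n A) (β : ℕ → B) (k : ℕ) (j : ℤ) :
    ∑' j', L.edgeWeight θ β k j j' ≤ L.branching :=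
  tsum_indicator_abs_binCenter_sub_le hΔ hr _

theorem tsum_startWeight_le (hΔ : 0 < L.Δ) (hr : 0 ≤ edgeRadius L.lam L.Ω L.Δ n)
    (θ : Labels n A) (β : ℕ → B) (i : ℕ) : ∑' j, L.startWeight θ β i j ≤ L.branching := by
  cases i with
  | zero => exact tsum_indicator_abs_binCenter_sub_le hΔ hr _
  | succ i => exact tsum_edgeWeight_le hΔ hr θ β i _

theorem tsum_pathWeight_succ_le (hΔ : 0 < L.Δ) (hr : 0 ≤ edgeRadius L.lam L.Ω L.Δ n) (s : ℝ)
    (θ : Labels n A) (β : ℕ → B) (i d : ℕ) :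
    ∑' j, L.pathWeight s θ β i (d + 1) j ≤ L.branching * L.rivalWeight s θ β i d := by
  simp only [pathWeight]
  rw [ENNReal.tsum_comm, rivalWeight, ← ENNReal.tsum_mul_left]
  refine ENNReal.tsum_le_tsum fun j => ?_
  rw [ENNReal.tsum_mul_right]
  gcongr
  exact tsum_edgeWeight_le hΔ hr θ β _ j

theorem tiltedProb_succ (s : ℝ) (θ : Labels n A) (β : ℕ → B) (i d : ℕ) :
    L.tiltedProb s θ β i (d + 1) = L.tiltedProb s θ β i d * L.stageProb θ β (i + d) ^ s := by
  rw [tiltedProb, tiltedProb, Finset.prod_range_succ, mul_assoc]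

theorem binProb_splice [Nonempty B] (θ : Labels n A) (β : ℕ → B) (m : ℕ) (y : Fin n → B)
    (j : ℤ) : L.binProb θ (splice (m * n) β y) m j = wordProb L.P (θ (m, j)) y := by
  rw [binProb]
  congr 1
  exact funext fun i => splice_add i

/-- The stage probabilities are the probabilities of the output words. -/
theorem sumOutputs_prod_stageProb [Fintype B] [Nonempty B] (hC : L.IsCausal) (θ : Labels n A)
    (K : ℕ) :
    sumOutputs (K * n) (fun β => ∏ k ∈ Finset.range K, L.stageProb θ β k) = 1 := by
  induction K with
  | zero =>
    have : Unique (Fin (0 * n) → B) := by rw [zero_mul]; infer_instance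
    simp [sumOutputs]
  | succ K ih =>
    rw [add_mul, one_mul, sumOutputs_add, ← ih]
    refine Finset.sum_congr rfl fun b _ => ?_
    have h : ∀ y : Fin n → B, ∏ k ∈ Finset.range (K + 1),
        L.stageProb θ (splice (K * n) (extendSeq b) y) k =
        (∏ k ∈ Finset.range K, L.stageProb θ (extendSeq b) k) *
          wordProb L.P (θ (K, L.trueBin θ (extendSeq b) K)) y := by
      intro y
      have hag := agreeBefore_splice θ (extendSeq b) K y
      rw [Finset.prod_range_succ, stageProb, binProb_splice, trueBin_congr hC hag]
      congr 1
      exact Finset.prod_congr rfl fun k hk =>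
        stageProb_congr hC (hag.mono (Finset.mem_range.1 hk))
    simp_rw [h, ← Finset.mul_sum, sum_wordProb, mul_one]

end

variable {A B : Type*} [Fintype A] [Fintype B] [Nonempty B] [MeasurableSpace A]
  [DiscreteMeasurableSpace A] {n : ℕ} {L : Loop A B n}

/-- Averaging over the labels and the outputs of stage `i + d` gains the factor of Gallager's
sum. -/
theorem lintegral_rivalWeight_le (hC : L.IsCausal) (hn : 0 < n) (Q : PMF A) {s ρ : ℝ}
    (h0 : 0 ≤ ρ) (h1 : ρ ≤ 1) (i d : ℕ) :
    ∫⁻ θ, sumOutputs ((i + d + 1) * n) (fun β =>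
        L.tiltedProb s θ β i (d + 1) * L.rivalWeight s θ β i d ^ ρ) ∂(labelLaw n Q) ≤
      (∑ y : Fin n → B,
          (∫⁻ a, wordProb L.P a y ^ s ∂(Measure.pi fun _ => Q.toMeasure)) ^ (1 + ρ)) *
        ∫⁻ θ, sumOutputs ((i + d) * n) (fun β =>
          L.tiltedProb s θ β i d * (∑' j, L.pathWeight s θ β i d j) ^ ρ) ∂(labelLaw n Q) := by
  classical
  have hsplit : ∀ θ : Labels n A, sumOutputs ((i + d + 1) * n) (fun β =>
        L.tiltedProb s θ β i (d + 1) * L.rivalWeight s θ β i d ^ ρ) =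
      sumOutputs ((i + d) * n) fun β => L.tiltedProb s θ β i d * ∑ y : Fin n → B,
        wordProb L.P (θ (i + d, L.trueBin θ β (i + d))) y ^ s *
          (∑' j, if j = L.trueBin θ β (i + d) then 0 else
            wordProb L.P (θ (i + d, j)) y ^ s * L.pathWeight s θ β i d j) ^ ρ := by
    intro θ
    rw [add_mul (i + d), one_mul, sumOutputs_add]
    refine Finset.sum_congr rfl fun b _ => ?_
    beta_reduce
    rw [Finset.mul_sum]
    refine Finset.sum_congr rfl fun y _ => ?_
    have hag := agreeBefore_splice θ (extendSeq b) (i + d) y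
    rw [tiltedProb_succ, tiltedProb_congr hC s hag, stageProb, binProb_splice,
      trueBin_congr hC hag, rivalWeight, trueBin_congr hC hag, pathWeight_congr hC hn s hag,
      mul_assoc]
    simp_rw [binProb_splice]
  have hw : ∀ y : Fin n → B, Measurable fun a : Fin n → A => wordProb L.P a y ^ s := fun y =>
    .of_discrete
  have hpow : ∀ β : ℕ → B, Measurable fun θ =>
      L.tiltedProb s θ β i d * (∑' j, L.pathWeight s θ β i d j) ^ ρ := fun β =>
    (L.measurable_tiltedProb s β i d).mul
      ((Measurable.tsum fun j => L.measurable_pathWeight s β i d j).pow_const ρ)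
  have hlab : ∀ β : ℕ → B, ∀ y : Fin n → B, ∀ {f : Labels n A → ℤ}, Measurable f →
      Measurable fun θ : Labels n A => wordProb L.P (θ (i + d, f θ)) y ^ s := by
    intro β y f hf
    have h : Measurable fun q : Labels n A × ℤ => wordProb L.P (q.1 (i + d, q.2)) y ^ s :=
      measurable_from_prod_countable_left fun j => (hw y).comp (measurable_pi_apply (i + d, j))
    exact h.comp (measurable_id.prodMk hf)
  have hmeas : ∀ β : ℕ → B, Measurable fun θ =>
      L.tiltedProb s θ β i d * ∑ y : Fin n → B,
        wordProb L.P (θ (i + d, L.trueBin θ β (i + d))) y ^ s *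
          (∑' j, if j = L.trueBin θ β (i + d) then 0 else
            wordProb L.P (θ (i + d, j)) y ^ s * L.pathWeight s θ β i d j) ^ ρ := by
    intro β
    refine (L.measurable_tiltedProb s β i d).mul (Finset.measurable_fun_sum _ fun y _ => ?_)
    refine (hlab β y (L.measurable_trueBin β _)).mul
      ((Measurable.tsum fun j => ?_).pow_const ρ)
    exact Measurable.ite (measurableSet_eq_fun measurable_const (L.measurable_trueBin β _))
      measurable_const ((hlab β y measurable_const).mul (L.measurable_pathWeight s β i d j))
  simp_rw [hsplit]
  rw [lintegral_sumOutputs _ _ hmeas, lintegral_sumOutputs _ _ hpow, Finset.mul_sum]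
  refine Finset.sum_le_sum fun b _ => ?_
  have hag : ∀ θ θ' : Labels n A, (∀ k j, k ≠ i + d → θ (k, j) = θ' (k, j)) →
      AgreeBefore (i + d) θ θ' (extendSeq b) (extendSeq b) := fun θ θ' h =>
    ⟨fun k hk j => h k j hk.ne, fun _ _ => rfl⟩
  exact lintegral_stage_le (Measure.pi fun _ => Q.toMeasure) h0 h1 (i + d)
    (L.measurable_tiltedProb s _ i d) (L.measurable_trueBin _ _)
    (L.measurable_pathWeight s _ i d)
    (fun θ θ' h => tiltedProb_congr hC s (hag θ θ' h))
    (fun θ θ' h => trueBin_congr hC (hag θ θ' h))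
    (fun θ θ' h => pathWeight_congr hC hn s (hag θ θ' h)) hw

/-- The expected weight of the rival paths over `d + 1` stages decays exponentially in `d`. -/
theorem lintegral_rivalWeight_le_pow (hC : L.IsCausal) (hn : 0 < n) (hΔ : 0 < L.Δ)
    (hr : 0 ≤ edgeRadius L.lam L.Ω L.Δ n) (Q : PMF A) {s ρ : ℝ} (h0 : 0 ≤ ρ) (h1 : ρ ≤ 1)
    (i d : ℕ) :
    ∫⁻ θ, sumOutputs ((i + d + 1) * n) (fun β =>
        L.tiltedProb s θ β i (d + 1) * L.rivalWeight s θ β i d ^ ρ) ∂(labelLaw n Q) ≤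
      ((∑ y : Fin n → B,
          (∫⁻ a, wordProb L.P a y ^ s ∂(Measure.pi fun _ => Q.toMeasure)) ^ (1 + ρ)) *
        L.branching ^ ρ) ^ (d + 1) := by
  have hprob : IsProbabilityMeasure (labelLaw n Q) := by unfold labelLaw; infer_instance
  have hne : L.branching ^ ρ ≠ ∞ := ENNReal.rpow_ne_top_of_nonneg h0 ENNReal.ofReal_ne_top
  refine (lintegral_rivalWeight_le hC hn Q h0 h1 i d).trans ?_
  rw [pow_succ', mul_assoc]
  gcongr
  induction d with
  | zero =>
    calc ∫⁻ θ, sumOutputs ((i + 0) * n) (fun β =>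
          L.tiltedProb s θ β i 0 * (∑' j, L.pathWeight s θ β i 0 j) ^ ρ) ∂(labelLaw n Q)
        ≤ ∫⁻ _, L.branching ^ ρ ∂(labelLaw n Q) := by
          refine lintegral_mono fun θ => ?_
          rw [← mul_one (L.branching ^ ρ), ← sumOutputs_prod_stageProb hC θ i, add_zero,
            sumOutputs, sumOutputs, Finset.mul_sum]
          refine Finset.sum_le_sum fun b _ => ?_
          rw [mul_comm, tiltedProb, Finset.prod_range_zero, mul_one]
          gcongr
          exact tsum_startWeight_le hΔ hr θ _ i
      _ = L.branching ^ ρ * _ ^ 0 := by simp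
  | succ d ih =>
    calc ∫⁻ θ, sumOutputs ((i + (d + 1)) * n) (fun β => L.tiltedProb s θ β i (d + 1) *
          (∑' j, L.pathWeight s θ β i (d + 1) j) ^ ρ) ∂(labelLaw n Q)
        ≤ ∫⁻ θ, L.branching ^ ρ * sumOutputs ((i + d + 1) * n) (fun β =>
            L.tiltedProb s θ β i (d + 1) * L.rivalWeight s θ β i d ^ ρ) ∂(labelLaw n Q) := by
          refine lintegral_mono fun θ => ?_
          rw [sumOutputs, sumOutputs, Finset.mul_sum]
          refine Finset.sum_le_sum fun b _ => ?_
          rw [mul_left_comm, ← ENNReal.mul_rpow_of_nonneg _ _ h0]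
          gcongr
          exact tsum_pathWeight_succ_le hΔ hr s θ _ i d
      _ ≤ _ := by
          rw [lintegral_const_mul' _ _ hne]
          gcongr
          refine (lintegral_rivalWeight_le hC hn Q h0 h1 i d).trans ?_
          rw [pow_succ', mul_assoc]
          gcongr

end Loop

namespace Loop

/-! ### The last departure of the decoded path from the true path -/

/-- The standing assumptions on a closed loop with observation noise bounded by `Γ / 2`. -/
structure Admissible {A B : Type*} [MeasurableSpace A] {n : ℕ} (L : Loop A B n) (Γ : ℝ) :
    Prop where
  one_lt_lam : 1 < L.lam
  n_pos : 0 < n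
  Ω_nonneg : 0 ≤ L.Ω
  Δ_pos : 0 < L.Δ
  two_mul_Γ_le : 2 * Γ ≤ L.Δ
  abs_w_le : ∀ t, |L.w t| ≤ L.Ω / 2
  abs_ν_le : ∀ t, |L.ν t| ≤ Γ / 2
  causal : L.IsCausal
  ml : IsMLTrellisController L.P L.lam L.Ω L.Δ n L.C

variable {A B : Type*} [MeasurableSpace A] {n : ℕ} {L : Loop A B n} {Γ : ℝ} {θ : Labels n A}
  {β : ℕ → B}

theorem Admissible.lam_nonneg (h : L.Admissible Γ) : 0 ≤ L.lam := zero_le_one.trans h.one_lt_lam.le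

theorem Admissible.edgeRadius_nonneg (h : L.Admissible Γ) : 0 ≤ edgeRadius L.lam L.Ω L.Δ n :=
  (half_pos h.Δ_pos).le.trans (half_le_edgeRadius h.lam_nonneg h.Ω_nonneg h.Δ_pos n)

theorem control_eq_zero (h : L.Admissible Γ) {t : ℕ} (ht : ¬ n ∣ t + 1) : L.control θ β t = 0 :=
  h.ml.1 t θ _ ht

theorem control_stage_eq_zero (h : L.Admissible Γ) (k : ℕ) {s : ℕ} (hs : s + 1 < n) :
    L.control θ β (k * n + s) = 0 := by
  refine control_eq_zero h ?_
  rw [add_assoc, Nat.dvd_add_right (dvd_mul_left n k)]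
  exact Nat.not_dvd_of_pos_of_lt s.succ_pos hs

theorem edgeWeight_eq_one_iff {k : ℕ} {j j' : ℤ} : L.edgeWeight θ β k j j' = 1 ↔
    |binCenter L.Δ j' - (L.lam ^ n * binCenter L.Δ j + L.control θ β (k * n + (n - 1)))| ≤
      edgeRadius L.lam L.Ω L.Δ n := by
  rw [edgeWeight]; split_ifs with h <;> simp [h]

theorem edgeWeight_eq_one (h : L.Admissible Γ) {k : ℕ} {j j' : ℤ}
    (he : IsTrellisEdge L.lam L.Ω L.Δ n (L.control θ β) k j j') :
    L.edgeWeight θ β k j j' = 1 :=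
  edgeWeight_eq_one_iff.2 (he.abs_binCenter_sub_le h.lam_nonneg h.n_pos
    fun _ hs => control_stage_eq_zero h k hs)

theorem startWeight_zero_eq_one (h : L.Admissible Γ) {j : ℤ} (hj : (0 : ℝ) ∈ bin L.Δ j) :
    L.startWeight θ β 0 j = 1 := by
  have h1 := abs_sub_binCenter_le hj
  have h2 := half_le_edgeRadius h.lam_nonneg h.Ω_nonneg h.Δ_pos n
  rw [zero_sub, abs_neg] at h1
  rw [startWeight, sub_zero, if_pos (h1.trans h2)]

theorem isTrellisPath_trueBin (h : L.Admissible Γ) (k : ℕ) :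
    IsTrellisPath L.lam L.Ω L.Δ n (L.control θ β) k fun i => L.trueBin θ β i :=
  isTrellisPath_quantize h.Δ_pos h.two_mul_Γ_le h.abs_w_le h.abs_ν_le k

theorem isTrellisEdge_trueBin (h : L.Admissible Γ) (k : ℕ) :
    IsTrellisEdge L.lam L.Ω L.Δ n (L.control θ β) k (L.trueBin θ β k) (L.trueBin θ β (k + 1)) :=
  (isTrellisPath_trueBin h (k + 1)).2 (Fin.last k)

theorem startWeight_trueBin (h : L.Admissible Γ) (i : ℕ) :
    L.startWeight θ β i (L.trueBin θ β i) = 1 := by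
  cases i with
  | zero => exact startWeight_zero_eq_one h (isTrellisPath_trueBin h 0).1
  | succ i => exact edgeWeight_eq_one h (isTrellisEdge_trueBin h i)

theorem abs_binCenter_sub_le_of_startWeight {i : ℕ} {j j' : ℤ}
    (h1 : L.startWeight θ β i j = 1) (h2 : L.startWeight θ β i j' = 1) :
    |binCenter L.Δ j - binCenter L.Δ j'| ≤ 2 * edgeRadius L.lam L.Ω L.Δ n := by
  have key : ∃ v, ∀ j, L.startWeight θ β i j = 1 →
      |binCenter L.Δ j - v| ≤ edgeRadius L.lam L.Ω L.Δ n := by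
    cases i with
    | zero =>
      refine ⟨0, fun j hj => ?_⟩
      rw [startWeight] at hj
      by_contra hc
      rw [if_neg hc] at hj
      exact zero_ne_one hj
    | succ i => exact ⟨_, fun j hj => edgeWeight_eq_one_iff.1 hj⟩
  obtain ⟨v, hv⟩ := key
  calc |binCenter L.Δ j - binCenter L.Δ j'|
      = |(binCenter L.Δ j - v) - (binCenter L.Δ j' - v)| := by congr 1; ring
    _ ≤ |binCenter L.Δ j - v| + |binCenter L.Δ j' - v| := abs_sub _ _
    _ ≤ 2 * edgeRadius L.lam L.Ω L.Δ n := by linarith [hv j h1, hv j' h2]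

theorem abs_binCenter_sub_le_of_edgeWeight (hlam : 0 ≤ L.lam) {k : ℕ} {j₁ j₂ j₁' j₂' : ℤ}
    (h1 : L.edgeWeight θ β k j₁ j₁' = 1) (h2 : L.edgeWeight θ β k j₂ j₂' = 1) :
    |binCenter L.Δ j₁' - binCenter L.Δ j₂'| ≤
      L.lam ^ n * |binCenter L.Δ j₁ - binCenter L.Δ j₂| +
        2 * edgeRadius L.lam L.Ω L.Δ n := by
  rw [edgeWeight_eq_one_iff] at h1 h2
  set u := L.control θ β (k * n + (n - 1))
  calc |binCenter L.Δ j₁' - binCenter L.Δ j₂'|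
      = |L.lam ^ n * (binCenter L.Δ j₁ - binCenter L.Δ j₂) +
          (binCenter L.Δ j₁' - (L.lam ^ n * binCenter L.Δ j₁ + u)) -
          (binCenter L.Δ j₂' - (L.lam ^ n * binCenter L.Δ j₂ + u))| := by congr 1; ring
    _ ≤ |L.lam ^ n * (binCenter L.Δ j₁ - binCenter L.Δ j₂) +
          (binCenter L.Δ j₁' - (L.lam ^ n * binCenter L.Δ j₁ + u))| +
          |binCenter L.Δ j₂' - (L.lam ^ n * binCenter L.Δ j₂ + u)| := abs_sub _ _
    _ ≤ |L.lam ^ n * (binCenter L.Δ j₁ - binCenter L.Δ j₂)| +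
          |binCenter L.Δ j₁' - (L.lam ^ n * binCenter L.Δ j₁ + u)| +
          |binCenter L.Δ j₂' - (L.lam ^ n * binCenter L.Δ j₂ + u)| := by
        gcongr; exact abs_add_le _ _
    _ ≤ _ := by rw [abs_mul, abs_of_nonneg (pow_nonneg hlam n)]; linarith

/-- `d` stages after leaving the true path, a rival path is at a distance of order
`lam ^ (n * (d + 1))` from it. -/
theorem abs_binCenter_sub_trueBin_le (h : L.Admissible Γ) {i d : ℕ} {q : ℕ → ℤ}
    (hstart : L.startWeight θ β i (q i) = 1)
    (hedge : ∀ e < d, L.edgeWeight θ β (i + e) (q (i + e)) (q (i + e + 1)) = 1) :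
    |binCenter L.Δ (q (i + d)) - binCenter L.Δ (L.trueBin θ β (i + d))| ≤
      2 * edgeRadius L.lam L.Ω L.Δ n / (L.lam ^ n - 1) * ((L.lam ^ n) ^ (d + 1) - 1) := by
  have h1 : 0 < L.lam ^ n - 1 := sub_pos.2 (one_lt_pow₀ h.one_lt_lam h.n_pos.ne')
  induction d with
  | zero =>
    rw [zero_add, pow_one, div_mul_cancel₀ _ h1.ne']
    exact abs_binCenter_sub_le_of_startWeight hstart (startWeight_trueBin h i)
  | succ d ih =>
    have h2 := abs_binCenter_sub_le_of_edgeWeight h.lam_nonneg (hedge d d.lt_succ_self)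
      (edgeWeight_eq_one h (isTrellisEdge_trueBin h (i + d)))
    have h3 := mul_le_mul_of_nonneg_left (ih fun e he => hedge e (he.trans d.lt_succ_self))
      (pow_nonneg h.lam_nonneg n)
    refine (h2.trans (add_le_add_left h3 _)).trans_eq ?_
    field_simp
    ring

theorem prod_binProb_rpow_le_pathWeight {s : ℝ} (hs : 0 ≤ s) {i d : ℕ} {q : ℕ → ℤ}
    (hstart : L.startWeight θ β i (q i) = 1)
    (hedge : ∀ e < d, L.edgeWeight θ β (i + e) (q (i + e)) (q (i + e + 1)) = 1)
    (hne : ∀ e < d, q (i + e) ≠ L.trueBin θ β (i + e)) :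
    (∏ e ∈ Finset.range d, L.binProb θ β (i + e) (q (i + e))) ^ s ≤
      L.pathWeight s θ β i d (q (i + d)) := by
  induction d with
  | zero => simp [pathWeight, hstart]
  | succ d ih =>
    have ih := ih (fun e he => hedge e (he.trans d.lt_succ_self))
      fun e he => hne e (he.trans d.lt_succ_self)
    rw [pathWeight, Finset.prod_range_succ, ENNReal.mul_rpow_of_nonneg _ _ hs, mul_comm]
    refine le_trans ?_ (ENNReal.le_tsum (q (i + d)))
    rw [if_neg (hne d d.lt_succ_self), ← add_assoc, hedge d d.lt_succ_self, one_mul]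
    gcongr

theorem prod_binProb_rpow_le_rivalWeight {s : ℝ} (hs : 0 ≤ s) {i d : ℕ} {q : ℕ → ℤ}
    (hstart : L.startWeight θ β i (q i) = 1)
    (hedge : ∀ e < d, L.edgeWeight θ β (i + e) (q (i + e)) (q (i + e + 1)) = 1)
    (hne : ∀ e ≤ d, q (i + e) ≠ L.trueBin θ β (i + e)) :
    (∏ e ∈ Finset.range (d + 1), L.binProb θ β (i + e) (q (i + e))) ^ s ≤
      L.rivalWeight s θ β i d := by
  rw [rivalWeight, Finset.prod_range_succ, ENNReal.mul_rpow_of_nonneg _ _ hs, mul_comm]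
  refine le_trans ?_ (ENNReal.le_tsum (q (i + d)))
  rw [if_neg (hne d le_rfl)]
  gcongr
  exact prod_binProb_rpow_le_pathWeight hs hstart hedge fun e he => hne e he.le

theorem controls_eq_control [Nonempty B] {T t : ℕ} (b : Fin T → B) (ht : t < T) :
    controls L.C θ b t = L.control θ (extendSeq b) t := by
  rw [controls, dif_pos ht, control]
  congr 1
  funext i
  exact (extendSeq_apply b (by have := i.isLt; omega)).symm

theorem pathLikelihood_eq [Nonempty B] {k : ℕ} (b : Fin ((k + 1) * n) → B) (q : ℕ → ℤ) :
    pathLikelihood L.P n θ k b (fun i => q i) =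
      ∏ m ∈ Finset.range (k + 1), L.binProb θ (extendSeq b) m (q m) := by
  rw [pathLikelihood, Finset.prod_range]
  refine Finset.prod_congr rfl fun i _ => Finset.prod_congr rfl fun m _ => ?_
  have hv : (finProdFinEquiv (i, m) : ℕ) = i * n + m := by
    rw [finProdFinEquiv_apply_val]; ring
  have : b (finProdFinEquiv (i, m)) = extendSeq b (i * n + m) := by
    rw [← hv, extendSeq_apply _ (finProdFinEquiv (i, m)).isLt]
  rw [this]

/-- The path decoded in stage `k`, which is at least as likely as every path that follows it up to
a stage where it meets the true path, and follows the true path from there on. -/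
theorem exists_decodedPath [Nonempty B] (h : L.Admissible Γ) (θ : Labels n A) (k : ℕ)
    (b : Fin ((k + 1) * n) → B) :
    ∃ q : ℕ → ℤ, (0 : ℝ) ∈ bin L.Δ (q 0) ∧
      (∀ i < k, L.edgeWeight θ (extendSeq b) i (q i) (q (i + 1)) = 1) ∧
      L.control θ (extendSeq b) (k * n + (n - 1)) = -L.lam ^ n * binCenter L.Δ (q k) ∧
      ∀ i ≤ k, (∀ i', i = i' + 1 → q i' = L.trueBin θ (extendSeq b) i') →
        ∏ m ∈ Finset.range (k + 1), L.binProb θ (extendSeq b) m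
            (if m < i then q m else L.trueBin θ (extendSeq b) m) ≤
          ∏ m ∈ Finset.range (k + 1), L.binProb θ (extendSeq b) m (q m) := by
  obtain ⟨p, ⟨hp, hmax⟩, hu⟩ := h.ml.2 θ k b
  have hn := h.n_pos
  have hlast : (k + 1) * n - 1 = k * n + (n - 1) := by rw [add_mul, one_mul]; omega
  have hctl : ∀ t < k * n, controls L.C θ b t = L.control θ (extendSeq b) t := fun t ht =>
    controls_eq_control b (by rw [add_mul]; omega)
  obtain ⟨q, rfl⟩ : ∃ q : ℕ → ℤ, p = fun i : Fin (k + 1) => q i :=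
    ⟨fun m => if hm : m < k + 1 then p ⟨m, hm⟩ else 0,
      by funext i; simp only [Fin.is_lt, dite_true]⟩
  have hq := hp.congr hctl
  have hqe : ∀ i < k, IsTrellisEdge L.lam L.Ω L.Δ n (L.control θ (extendSeq b)) i
      (q i) (q (i + 1)) := fun i hi => hq.2 ⟨i, hi⟩
  refine ⟨q, hq.1, fun i hi => edgeWeight_eq_one h (hqe i hi), ?_, fun i hi hmeet => ?_⟩
  · rw [← hlast, ← controls_eq_control b (by rw [add_mul]; omega), hu]
    rfl
  · rw [← pathLikelihood_eq b q, ← pathLikelihood_eq b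
      (fun m => if m < i then q m else L.trueBin θ (extendSeq b) m)]
    refine hmax _ (IsTrellisPath.congr (u := L.control θ (extendSeq b)) ⟨?_, fun m => ?_⟩
      fun t ht => (hctl t ht).symm)
    · by_cases h0 : 0 < i
      · simpa [h0] using hq.1
      · simpa [h0] using (isTrellisPath_trueBin h k).1
    · have hm := m.isLt
      have htrue := isTrellisEdge_trueBin (θ := θ) (β := extendSeq b) h (m : ℕ)
      simp only [Fin.val_castSucc, Fin.val_succ]
      rcases lt_trichotomy ((m : ℕ) + 1) i with h1 | h1 | h1
      · rw [if_pos (by omega), if_pos h1]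
        exact hqe m hm
      · rw [if_pos (by omega), if_neg (by omega), hmeet m h1.symm]
        exact htrue
      · rw [if_neg (by omega), if_neg (by omega)]
        exact htrue

/-- The constant in the bound on the state in terms of the length of the last departure. -/
noncomputable def stateConst (L : Loop A B n) : ℝ :=
  L.lam ^ n * (L.Δ / 2 + 2 * edgeRadius L.lam L.Ω L.Δ n / (L.lam ^ n - 1)) +
    noiseRadius L.lam L.Ω n

theorem abs_state_succ_le (h : L.Admissible Γ) {k : ℕ} {j : ℤ}
    (hu : L.control θ β (k * n + (n - 1)) = -L.lam ^ n * binCenter L.Δ j) :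
    |L.state θ β ((k + 1) * n)| ≤
      L.lam ^ n * (L.Δ / 2 + |binCenter L.Δ j - binCenter L.Δ (L.trueBin θ β k)|) +
        noiseRadius L.lam L.Ω n := by
  have h1 := abs_plantState_stage_sub_le (lam := L.lam) (Ω := L.Ω) (x := L.state θ β (k * n))
    (u := fun s => L.control θ β (k * n + s)) (w := fun s => L.w (k * n + s)) h.lam_nonneg
    (fun t => h.abs_w_le _) h.n_pos fun s hs => control_stage_eq_zero h k hs
  have h2 : |L.state θ β (k * n) - binCenter L.Δ (L.trueBin θ β k)| ≤ L.Δ / 2 :=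
    abs_sub_binCenter_le (mem_bin_quantize_add h.Δ_pos h.two_mul_Γ_le (h.abs_ν_le _))
  have h3 : L.state θ β ((k + 1) * n) = plantState L.lam (L.state θ β (k * n))
      (fun s => L.control θ β (k * n + s)) (fun s => L.w (k * n + s)) n := by
    rw [add_mul, one_mul, state, plantState_add]; rfl
  rw [← h3, hu] at h1
  set x := L.state θ β (k * n)
  set y := L.state θ β ((k + 1) * n)
  set c := binCenter L.Δ (L.trueBin θ β k)
  have h4 : |L.lam ^ n * ((x - c) - (binCenter L.Δ j - c))| ≤
      L.lam ^ n * (L.Δ / 2 + |binCenter L.Δ j - c|) := by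
    rw [abs_mul, abs_of_nonneg (pow_nonneg h.lam_nonneg n)]
    refine mul_le_mul_of_nonneg_left ?_ (pow_nonneg h.lam_nonneg n)
    exact (abs_sub _ _).trans (by gcongr)
  calc |y| = |L.lam ^ n * ((x - c) - (binCenter L.Δ j - c)) +
        (y - (L.lam ^ n * x + -L.lam ^ n * binCenter L.Δ j))| := by congr 1; ring
    _ ≤ _ := (abs_add_le _ _).trans (add_le_add h4 h1)

/-- Either the decoded bin is the true one and the state is bounded, or the decoded path left the
true path for the last time before some stage `i`; then the state is of the order of
`lam ^ (n * (k + 1 - i))`, while the outputs make the rival paths likely. -/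
theorem state_le_or_exists_departure [Nonempty B] (h : L.Admissible Γ) {s ρ : ℝ} (hs : 0 ≤ s)
    (hρ : 0 ≤ ρ) (hsρ : s + s * ρ = 1) (θ : Labels n A) (k : ℕ) (b : Fin ((k + 1) * n) → B) :
    |L.state θ (extendSeq b) ((k + 1) * n)| ≤ L.stateConst ∨
    ∃ i d, i + d = k ∧
      |L.state θ (extendSeq b) ((k + 1) * n)| ≤ L.stateConst * (L.lam ^ n) ^ (d + 1) ∧
      ∏ m ∈ Finset.range (k + 1), L.stageProb θ (extendSeq b) m ≤
        L.tiltedProb s θ (extendSeq b) i (d + 1) *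
          L.rivalWeight s θ (extendSeq b) i d ^ ρ := by
  classical
  obtain ⟨q, hq0, hqe, hu, hq⟩ := exists_decodedPath h θ k b
  set β := extendSeq b
  have hx := abs_state_succ_le h hu
  have hΛ : 1 < L.lam ^ n := one_lt_pow₀ h.one_lt_lam h.n_pos.ne'
  have hE : 0 ≤ 2 * edgeRadius L.lam L.Ω L.Δ n / (L.lam ^ n - 1) :=
    div_nonneg (mul_nonneg zero_le_two h.edgeRadius_nonneg) (by linarith)
  have hD := noiseRadius_nonneg h.lam_nonneg h.Ω_nonneg n
  by_cases hk : q k = L.trueBin θ β k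
  · left
    rw [hk, sub_self, abs_zero, add_zero] at hx
    refine hx.trans ?_
    rw [stateConst]
    gcongr
    linarith
  right
  -- The start `i` of the last run of stages in which the decoded path differs from the true one.
  have hex : ∃ i, i ≤ k ∧ ∀ m, i ≤ m → m ≤ k → q m ≠ L.trueBin θ β m :=
    ⟨k, le_rfl, fun m h1 h2 => le_antisymm h1 h2 ▸ hk⟩
  obtain ⟨i, ⟨hik, hne⟩, hmin⟩ : ∃ i, (i ≤ k ∧ ∀ m, i ≤ m → m ≤ k → q m ≠ L.trueBin θ β m) ∧
      ∀ i' < i, ¬ (i' ≤ k ∧ ∀ m, i' ≤ m → m ≤ k → q m ≠ L.trueBin θ β m) :=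
    ⟨Nat.find hex, Nat.find_spec hex, fun _ => Nat.find_min hex⟩
  have hmeet : ∀ i', i = i' + 1 → q i' = L.trueBin θ β i' := by
    rintro i' rfl
    by_contra hc
    refine hmin i' i'.lt_succ_self ⟨by omega, fun m h1 h2 => ?_⟩
    rcases h1.eq_or_lt with rfl | h1
    · exact hc
    · exact hne m h1 h2
  obtain ⟨d, rfl⟩ := Nat.exists_eq_add_of_le hik
  have hstart : L.startWeight θ β i (q i) = 1 := by
    cases i with
    | zero => exact startWeight_zero_eq_one h hq0
    | succ i => rw [startWeight, ← hmeet i rfl]; exact hqe i (by omega)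
  have hedge : ∀ e < d, L.edgeWeight θ β (i + e) (q (i + e)) (q (i + e + 1)) = 1 := fun e he =>
    hqe _ (by omega)
  refine ⟨i, d, rfl, ?_, ?_⟩
  · have h1 := abs_binCenter_sub_trueBin_le h hstart hedge
    have h2 : 1 ≤ (L.lam ^ n) ^ (d + 1) := one_le_pow₀ hΛ.le
    refine hx.trans ?_
    rw [stateConst, add_mul, mul_assoc, add_mul]
    have h3 : L.Δ / 2 ≤ L.Δ / 2 * (L.lam ^ n) ^ (d + 1) :=
      le_mul_of_one_le_right (half_pos h.Δ_pos).le h2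
    have h4 : noiseRadius L.lam L.Ω n ≤ noiseRadius L.lam L.Ω n * (L.lam ^ n) ^ (d + 1) :=
      le_mul_of_one_le_right hD h2
    have h5 : |binCenter L.Δ (q (i + d)) - binCenter L.Δ (L.trueBin θ β (i + d))| ≤
        2 * edgeRadius L.lam L.Ω L.Δ n / (L.lam ^ n - 1) * (L.lam ^ n) ^ (d + 1) :=
      h1.trans (mul_le_mul_of_nonneg_left (by linarith) hE)
    exact add_le_add (mul_le_mul_of_nonneg_left (add_le_add h3 h5) (by linarith)) h4
  · set Y := ∏ e ∈ Finset.range (d + 1), L.binProb θ β (i + e) (q (i + e))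
    set X := ∏ e ∈ Finset.range (d + 1), L.stageProb θ β (i + e)
    set Z := ∏ m ∈ Finset.range i, L.binProb θ β m (q m)
    have hsplit : ∏ m ∈ Finset.range (i + d + 1), L.binProb θ β m (q m) = Z * Y := by
      rw [add_assoc, Finset.prod_range_add]
    have hZtop : Z ≠ ∞ := ENNReal.prod_ne_top fun m _ => wordProb_ne_top _ _ _
    by_cases hZ : Z = 0
    · -- The decoded path is impossible, and so is every other path, in particular the true one.
      have h0 := hq 0 (Nat.zero_le _) fun i' hi' => by omega
      simp only [Nat.not_lt_zero, if_false] at h0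
      rw [hsplit, hZ, zero_mul] at h0
      exact h0.trans zero_le
    · have h1 := hq i hik hmeet
      rw [hsplit, add_assoc, Finset.prod_range_add] at h1
      have h2 : ∏ m ∈ Finset.range i, L.binProb θ β m
          (if m < i then q m else L.trueBin θ β m) = Z :=
        Finset.prod_congr rfl fun m hm => by rw [if_pos (Finset.mem_range.1 hm)]
      have h3 : ∏ e ∈ Finset.range (d + 1), L.binProb θ β (i + e)
          (if i + e < i then q (i + e) else L.trueBin θ β (i + e)) = X :=
        Finset.prod_congr rfl fun e _ => by rw [if_neg (by omega), stageProb]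
      rw [h2, h3, ENNReal.mul_le_mul_iff_right hZ hZtop] at h1
      have hY := prod_binProb_rpow_le_rivalWeight hs hstart hedge
        fun e he => hne (i + e) (by omega) (by omega)
      rw [add_assoc, Finset.prod_range_add, tiltedProb, mul_assoc,
        ENNReal.prod_rpow_of_nonneg hs]
      refine mul_le_mul_right ?_ _
      calc X = X ^ s * (X ^ s) ^ ρ := by
            rw [← ENNReal.rpow_mul, ← ENNReal.rpow_add_of_nonneg _ _ hs (mul_nonneg hs hρ), hsρ,
              ENNReal.rpow_one]
        _ ≤ X ^ s * L.rivalWeight s θ β i d ^ ρ := by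
            gcongr
            exact (ENNReal.rpow_le_rpow h1 hs).trans hY

end Loop

namespace Loop

/-! ### The moments of the state -/

section
variable {A B : Type*} [MeasurableSpace A] {n : ℕ} {L : Loop A B n} {Γ : ℝ}

/-- The conditional probability of the output at time `t`. -/
noncomputable def letterProb (L : Loop A B n) (hn : 0 < n) (θ : Labels n A) (β : ℕ → B) (t : ℕ) :
    ℝ≥0∞ := L.P (θ (t / n, L.trueBin θ β (t / n)) ⟨t % n, Nat.mod_lt t hn⟩) (β t)

theorem letterProb_mul_add (hn : 0 < n) (θ : Labels n A) (β : ℕ → B) (k : ℕ) (m : Fin n) :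
    L.letterProb hn θ β (k * n + m) = L.P (θ (k, L.trueBin θ β k) m) (β (k * n + m)) := by
  have h1 : (k * n + m) / n = k := by
    rw [mul_comm, Nat.mul_add_div hn, Nat.div_eq_of_lt m.isLt, add_zero]
  have h2 : (⟨(k * n + m) % n, Nat.mod_lt _ hn⟩ : Fin n) = m :=
    Fin.ext (by simp [Nat.mod_eq_of_lt m.isLt])
  rw [letterProb, h1, h2]

theorem prod_letterProb (hn : 0 < n) (θ : Labels n A) (β : ℕ → B) (K : ℕ) :
    ∏ t ∈ Finset.range (K * n), L.letterProb hn θ β t =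
      ∏ k ∈ Finset.range K, L.stageProb θ β k := by
  induction K with
  | zero => simp
  | succ K ih =>
    rw [add_mul, one_mul, Finset.prod_range_add, ih, Finset.prod_range_succ,
      Finset.prod_range (n := n)]
    congr 1
    exact Finset.prod_congr rfl fun m _ => letterProb_mul_add hn θ β K m

theorem closedLoopState_eq [Nonempty B] (θ : Labels n A) {T t : ℕ} (b : Fin T → B) (ht : t ≤ T) :
    closedLoopState L.lam L.C L.w θ b t = L.state θ (extendSeq b) t :=
  plantState_congr fun _ hs => controls_eq_control b (hs.trans_le ht)

theorem outputProb_eq [Nonempty B] (hn : 0 < n) (θ : Labels n A) {T : ℕ} (b : Fin T → B) :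
    outputProb L.P L.lam (latticeObserver n hn L.Δ) L.C L.w L.ν θ b =
      ∏ t ∈ Finset.range T, L.letterProb hn θ (extendSeq b) t := by
  rw [outputProb, Finset.prod_range]
  refine Finset.prod_congr rfl fun t _ => ?_
  have hle : (t : ℕ) / n * n ≤ T := (Nat.div_mul_le_self t n).trans t.isLt.le
  change L.P (θ ((t : ℕ) / n, quantize L.Δ (closedLoopState L.lam L.C L.w θ b ((t : ℕ) / n * n) +
    L.ν ((t : ℕ) / n * n))) ⟨(t : ℕ) % n, _⟩) (b t) = _
  rw [closedLoopState_eq θ b hle, letterProb, trueBin, extendSeq_apply b t.isLt]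

theorem abs_state_add_le (h : L.Admissible Γ) (θ : Labels n A) (β : ℕ → B) (K : ℕ) {s : ℕ}
    (hs : s < n) : |L.state θ β (K * n + s)| ≤
      L.lam ^ n * |L.state θ β (K * n)| + noiseRadius L.lam L.Ω n := by
  have h1 := abs_plantState_sub_le_of_idle (lam := L.lam) (Ω := L.Ω) (x := L.state θ β (K * n))
    (u := fun t => L.control θ β (K * n + t)) (w := fun t => L.w (K * n + t)) h.lam_nonneg
    (t := s) (fun t => h.abs_w_le _) fun t ht => control_stage_eq_zero h K (by omega)
  have h2 : L.state θ β (K * n + s) = plantState L.lam (L.state θ β (K * n))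
      (fun t => L.control θ β (K * n + t)) (fun t => L.w (K * n + t)) s := by
    rw [state, plantState_add]; rfl
  rw [← h2] at h1
  have h3 := noiseRadius_mono h.lam_nonneg h.Ω_nonneg hs.le
  have h4 : L.lam ^ s ≤ L.lam ^ n := pow_le_pow_right₀ h.one_lt_lam.le hs.le
  calc |L.state θ β (K * n + s)|
      = |L.lam ^ s * L.state θ β (K * n) +
          (L.state θ β (K * n + s) - L.lam ^ s * L.state θ β (K * n))| := by congr 1; ring
    _ ≤ |L.lam ^ s * L.state θ β (K * n)| + noiseRadius L.lam L.Ω n :=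
        (abs_add_le _ _).trans (by gcongr; exact h1.trans h3)
    _ ≤ _ := by
        rw [abs_mul, abs_of_nonneg (pow_nonneg h.lam_nonneg s)]
        gcongr

theorem stateConst_nonneg (h : L.Admissible Γ) : 0 ≤ L.stateConst := by
  have hΛ : 1 < L.lam ^ n := one_lt_pow₀ h.one_lt_lam h.n_pos.ne'
  have h1 := h.edgeRadius_nonneg
  have h2 := noiseRadius_nonneg h.lam_nonneg h.Ω_nonneg n
  have h3 := h.Δ_pos
  have h4 : 0 ≤ 2 * edgeRadius L.lam L.Ω L.Δ n / (L.lam ^ n - 1) :=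
    div_nonneg (by positivity) (by linarith)
  rw [stateConst]
  positivity

/-- Moments at arbitrary times are reduced to the last sampling time: the outputs that follow it
are summed out. -/
theorem stateMoment_le [Fintype B] [Nonempty B] (h : L.Admissible Γ) (μ : Measure (Labels n A))
    {η : ℝ} (hη : 0 ≤ η) (K : ℕ) {s : ℕ} (hs : s < n) :
    stateMoment μ L.P L.lam η (latticeObserver n h.n_pos L.Δ) L.C L.w L.ν (K * n + s) ≤
      ∫⁻ θ, sumOutputs (K * n) (fun β => (∏ k ∈ Finset.range K, L.stageProb θ β k) *
        ENNReal.ofReal ((L.lam ^ n * |L.state θ β (K * n)| + noiseRadius L.lam L.Ω n) ^ η)) ∂μ := by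
  refine lintegral_mono fun θ => ?_
  set g : (ℕ → B) → ℝ≥0∞ := fun β =>
    ENNReal.ofReal ((L.lam ^ n * |L.state θ β (K * n)| + noiseRadius L.lam L.Ω n) ^ η)
  have h1 : (∑ b : Fin (K * n + s) → B,
      outputProb L.P L.lam (latticeObserver n h.n_pos L.Δ) L.C L.w L.ν θ b *
        ENNReal.ofReal (|closedLoopState L.lam L.C L.w θ b (K * n + s)| ^ η)) ≤
      sumOutputs (K * n + s) fun β =>
        (∏ t ∈ Finset.range (K * n + s), L.letterProb h.n_pos θ β t) * g β := by
    refine Finset.sum_le_sum fun b _ => ?_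
    rw [outputProb_eq, closedLoopState_eq θ b le_rfl]
    refine mul_le_mul_right (ENNReal.ofReal_le_ofReal ?_) _
    exact Real.rpow_le_rpow (abs_nonneg _) (abs_state_add_le h θ _ K hs) hη
  refine h1.trans_eq ?_
  rw [sumOutputs_add]
  refine Finset.sum_congr rfl fun b _ => ?_
  have hsplit : ∀ y : Fin s → B,
      (∏ t ∈ Finset.range (K * n + s),
          L.letterProb h.n_pos θ (splice (K * n) (extendSeq b) y) t) *
        g (splice (K * n) (extendSeq b) y) =
      (∏ k ∈ Finset.range K, L.stageProb θ (extendSeq b) k) * g (extendSeq b) *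
        wordProb L.P (fun m : Fin s =>
          θ (K, L.trueBin θ (extendSeq b) K) (Fin.castLE hs.le m)) y := by
    intro y
    have hag : AgreeBefore K θ θ (splice (K * n) (extendSeq b) y) (extendSeq b) :=
      ⟨fun _ _ _ => rfl, fun _ ht => splice_of_lt ht⟩
    have hg : g (splice (K * n) (extendSeq b) y) = g (extendSeq b) := by
      simp only [g, state]
      rw [plantState_congr fun t ht => control_congr h.causal hag ht]
    rw [Finset.prod_range_add, prod_letterProb, hg, mul_right_comm]
    congr 1
    · congr 1
      exact Finset.prod_congr rfl fun k hk =>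
        stageProb_congr h.causal (hag.mono (Finset.mem_range.1 hk))
    · rw [Finset.prod_range]
      refine Finset.prod_congr rfl fun m _ => ?_
      have := letterProb_mul_add (L := L) h.n_pos θ (splice (K * n) (extendSeq b) y) K
        (Fin.castLE hs.le m)
      rw [Fin.val_castLE, splice_add, trueBin_congr h.causal hag] at this
      exact this
  beta_reduce
  simp_rw [hsplit]
  rw [← Finset.mul_sum, sum_wordProb, mul_one]

end

variable {A B : Type*} [Fintype A] [Fintype B] [Nonempty B] [MeasurableSpace A]
  [DiscreteMeasurableSpace A] {n : ℕ} {L : Loop A B n} {Γ : ℝ}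

/-- The moment at a sampling time is bounded by a geometric series, summed over the length of the
last departure of the decoded path from the true one. -/
theorem lintegral_sampled_moment_le (h : L.Admissible Γ) (Q : PMF A) {η s ρ : ℝ} (hη : 0 ≤ η)
    (hs : 0 ≤ s) (h0 : 0 ≤ ρ) (h1 : ρ ≤ 1) (hsρ : s + s * ρ = 1) (K : ℕ) :
    ∫⁻ θ, sumOutputs (K * n) (fun β => (∏ k ∈ Finset.range K, L.stageProb θ β k) *
        ENNReal.ofReal ((L.lam ^ n * |L.state θ β (K * n)| + noiseRadius L.lam L.Ω n) ^ η))
        ∂(labelLaw n Q) ≤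
      ENNReal.ofReal ((L.lam ^ n * L.stateConst + noiseRadius L.lam L.Ω n) ^ η) *
        ∑' d : ℕ, (ENNReal.ofReal ((L.lam ^ n) ^ η) *
          ((∑ y : Fin n → B,
            (∫⁻ a, wordProb L.P a y ^ s ∂(Measure.pi fun _ => Q.toMeasure)) ^ (1 + ρ)) *
          L.branching ^ ρ)) ^ d := by
  have hprob : IsProbabilityMeasure (labelLaw n Q) := by unfold labelLaw; infer_instance
  have hΛ : 1 < L.lam ^ n := one_lt_pow₀ h.one_lt_lam h.n_pos.ne'
  have hD := noiseRadius_nonneg h.lam_nonneg h.Ω_nonneg n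
  have hK := stateConst_nonneg h
  set c := ENNReal.ofReal ((L.lam ^ n * L.stateConst + noiseRadius L.lam L.Ω n) ^ η) with hc
  set z := ENNReal.ofReal ((L.lam ^ n) ^ η) with hz
  set x := (∑ y : Fin n → B,
    (∫⁻ a, wordProb L.P a y ^ s ∂(Measure.pi fun _ => Q.toMeasure)) ^ (1 + ρ)) *
      L.branching ^ ρ
  have hgeom : ∀ r : ℝ, r ≤ L.stateConst → 0 ≤ r →
      ENNReal.ofReal ((L.lam ^ n * r + noiseRadius L.lam L.Ω n) ^ η) ≤ c := by
    intro r hr hr0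
    refine ENNReal.ofReal_le_ofReal (Real.rpow_le_rpow (by positivity) ?_ hη)
    gcongr
  rcases K with _ | k
  · have hle : c ≤ c * ∑' d : ℕ, (z * x) ^ d := by
      conv_lhs => rw [← mul_one c, ← pow_zero (z * x)]
      gcongr
      exact ENNReal.le_tsum 0
    refine le_trans ?_ hle
    calc _ ≤ ∫⁻ _, c ∂(labelLaw n Q) := by
          refine lintegral_mono fun θ => ?_
          have : Unique (Fin (0 * n) → B) := by rw [zero_mul]; infer_instance
          simp only [sumOutputs, Finset.univ_unique, Finset.sum_singleton, Finset.range_zero,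
            Finset.prod_empty, one_mul]
          have hzero : ∀ β, L.state θ β (0 * n) = 0 := fun β => by rw [zero_mul]; rfl
          exact hgeom _ (by rwa [hzero, abs_zero]) (abs_nonneg _)
      _ = c := by simp
  -- The sum over all `i` absorbs the dependence of the last departure on the labels and outputs.
  have hpt : ∀ θ, ∀ b : Fin ((k + 1) * n) → B,
      (∏ m ∈ Finset.range (k + 1), L.stageProb θ (extendSeq b) m) * ENNReal.ofReal
        ((L.lam ^ n * |L.state θ (extendSeq b) ((k + 1) * n)| + noiseRadius L.lam L.Ω n) ^ η) ≤
      c * (∏ m ∈ Finset.range (k + 1), L.stageProb θ (extendSeq b) m) +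
        ∑ i ∈ Finset.range (k + 1), c * z ^ (k - i + 1) *
          (L.tiltedProb s θ (extendSeq b) i (k - i + 1) *
            L.rivalWeight s θ (extendSeq b) i (k - i) ^ ρ) := by
    intro θ b
    rcases state_le_or_exists_departure h hs h0 hsρ θ k b with hX | ⟨i, d, hid, hX, hp⟩
    · refine le_trans ?_ le_self_add
      rw [mul_comm]
      gcongr
      exact hgeom _ hX (abs_nonneg _)
    · refine le_trans ?_ le_add_self
      have hdk : k - i = d := by omega
      refine le_trans ?_ (Finset.single_le_sum (f := fun i => c * z ^ (k - i + 1) *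
          (L.tiltedProb s θ (extendSeq b) i (k - i + 1) *
            L.rivalWeight s θ (extendSeq b) i (k - i) ^ ρ)) (fun _ _ => zero_le)
        (Finset.mem_range.2 (by omega : i < k + 1)))
      rw [hdk, mul_comm]
      refine mul_le_mul' ?_ hp
      have hpow : 1 ≤ (L.lam ^ n) ^ (d + 1) := one_le_pow₀ hΛ.le
      rw [hc, hz, ← ENNReal.ofReal_pow (by positivity), ← ENNReal.ofReal_mul (by positivity),
        ← Real.rpow_natCast (((L.lam ^ n) ^ η)), ← Real.rpow_mul (by positivity), mul_comm η,
        Real.rpow_mul (by positivity), Real.rpow_natCast,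
        ← Real.mul_rpow (by positivity) (by positivity)]
      refine ENNReal.ofReal_le_ofReal (Real.rpow_le_rpow (by positivity) ?_ hη)
      rw [add_mul (L.lam ^ n * L.stateConst), mul_assoc (L.lam ^ n)]
      gcongr
      exact le_mul_of_one_le_right hD hpow
  have hmeas : ∀ i, Measurable fun θ => sumOutputs ((k + 1) * n) fun β =>
      L.tiltedProb s θ β i (k - i + 1) * L.rivalWeight s θ β i (k - i) ^ ρ := fun i =>
    Finset.measurable_fun_sum _ fun b _ => (L.measurable_tiltedProb s _ i _).mul
      ((L.measurable_rivalWeight s _ i _).pow_const ρ)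
  calc _ ≤ ∫⁻ θ, c + ∑ i ∈ Finset.range (k + 1), c * z ^ (k - i + 1) *
          sumOutputs ((k + 1) * n) (fun β =>
            L.tiltedProb s θ β i (k - i + 1) * L.rivalWeight s θ β i (k - i) ^ ρ)
          ∂(labelLaw n Q) := by
        refine lintegral_mono fun θ => (sumOutputs_mono (g' := fun β =>
          c * (∏ m ∈ Finset.range (k + 1), L.stageProb θ β m) +
            ∑ i ∈ Finset.range (k + 1), c * z ^ (k - i + 1) *
              (L.tiltedProb s θ β i (k - i + 1) * L.rivalWeight s θ β i (k - i) ^ ρ))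
          (hpt θ)).trans_eq ?_
        simp only [sumOutputs]
        rw [Finset.sum_add_distrib, ← Finset.mul_sum, Finset.sum_comm]
        congr 1
        · have := sumOutputs_prod_stageProb h.causal θ (k + 1)
          rw [sumOutputs] at this
          rw [this, mul_one]
        · exact Finset.sum_congr rfl fun i _ => by rw [Finset.mul_sum]
    _ = c + ∑ i ∈ Finset.range (k + 1), c * z ^ (k - i + 1) *
          ∫⁻ θ, sumOutputs ((k + 1) * n) (fun β =>
            L.tiltedProb s θ β i (k - i + 1) * L.rivalWeight s θ β i (k - i) ^ ρ)
          ∂(labelLaw n Q) := by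
        rw [lintegral_add_left measurable_const, lintegral_const, measure_univ, mul_one,
          lintegral_finsetSum _ fun i _ => (hmeas i).const_mul _]
        congr 1
        exact Finset.sum_congr rfl fun i _ => lintegral_const_mul _ (hmeas i)
    _ ≤ c + ∑ i ∈ Finset.range (k + 1), c * (z * x) ^ (k + 1 - 1 - i + 1) := by
        refine add_le_add le_rfl (Finset.sum_le_sum fun i hi => ?_)
        have hi := Finset.mem_range.1 hi
        have hk : (k + 1) * n = (i + (k - i) + 1) * n := by congr 2; omega
        rw [Nat.add_sub_cancel, mul_pow, ← mul_assoc, hk]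
        gcongr
        exact lintegral_rivalWeight_le_pow h.causal h.n_pos h.Δ_pos h.edgeRadius_nonneg Q h0 h1 i
          (k - i)
    _ = c * ∑ d ∈ Finset.range (k + 2), (z * x) ^ d := by
        rw [Finset.sum_range_reflect (fun d => c * (z * x) ^ (d + 1)) (k + 1), ← Finset.mul_sum,
          Finset.sum_range_succ' _ (k + 1), mul_add, pow_zero, mul_one, add_comm]
    _ ≤ c * ∑' d : ℕ, (z * x) ^ d := by
        gcongr
        exact ENNReal.sum_le_tsum _

end Loop

/-! ### Choice of the block length and of the bin width -/

theorem exists_blockLength {lam R : ℝ} (hlam : 1 < lam) (hR : Real.logb 2 lam < R) :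
    ∃ n : ℕ, 0 < n ∧ 2 * lam ^ n + 4 ≤ (2 : ℝ) ^ (n * R) := by
  have h0 : 0 < lam := by linarith
  have hg : lam < (2 : ℝ) ^ R := by
    rwa [← Real.logb_lt_iff_lt_rpow one_lt_two h0]
  obtain ⟨n, hn⟩ := pow_unbounded_of_one_lt 6 ((one_lt_div h0).2 hg)
  have hn0 : 0 < n := Nat.pos_of_ne_zero (by rintro rfl; norm_num at hn)
  refine ⟨n, hn0, ?_⟩
  rw [mul_comm (n : ℝ), Real.rpow_mul zero_le_two, Real.rpow_natCast]
  rw [div_pow, lt_div_iff₀ (by positivity)] at hn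
  have : 1 ≤ lam ^ n := one_le_pow₀ hlam.le
  linarith

/-- The ratio of the geometric series that bounds the moments is below `1` if
`E₀(ρ, Q) - ρ R > η log₂ lam` and the trellis has at most `2 ^ (n R)` branches. -/
theorem ratio_lt_one {lam η R ρ E br : ℝ} {n : ℕ} (hlam : 1 < lam) (hn : 0 < n) (h0 : 0 ≤ ρ)
    (hE : η * Real.logb 2 lam < E - ρ * R) (hbr0 : 0 ≤ br) (hbr : br ≤ (2 : ℝ) ^ (n * R)) :
    ENNReal.ofReal ((lam ^ n) ^ η) *
      (ENNReal.ofReal (2 ^ (-E)) ^ n * ENNReal.ofReal br ^ ρ) < 1 := by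
  have hl : 0 < lam := by linarith
  rw [ENNReal.ofReal_rpow_of_nonneg hbr0 h0, ← ENNReal.ofReal_pow (by positivity),
    ← ENNReal.ofReal_mul (by positivity), ← ENNReal.ofReal_mul (by positivity),
    ENNReal.ofReal_lt_one]
  have e1 : (lam ^ n) ^ η = (2 : ℝ) ^ (n * (η * Real.logb 2 lam)) := by
    conv_lhs => rw [← Real.rpow_logb two_pos (by norm_num) hl]
    rw [← Real.rpow_natCast, ← Real.rpow_mul zero_le_two, ← Real.rpow_mul zero_le_two]
    congr 1; ring
  have e2 : ((2 : ℝ) ^ (-E)) ^ n = 2 ^ (n * (-E)) := by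
    rw [← Real.rpow_natCast, ← Real.rpow_mul zero_le_two, mul_comm]
  have e3 : br ^ ρ ≤ 2 ^ (n * (R * ρ)) := by
    rw [← mul_assoc, Real.rpow_mul zero_le_two]
    exact Real.rpow_le_rpow hbr0 hbr h0
  calc (lam ^ n) ^ η * ((2 ^ (-E)) ^ n * br ^ ρ)
      ≤ 2 ^ (n * (η * Real.logb 2 lam)) * (2 ^ (n * (-E)) * 2 ^ (n * (R * ρ))) := by
        rw [e1, e2]; gcongr
    _ = 2 ^ (n * (η * Real.logb 2 lam - (E - ρ * R))) := by
        rw [← Real.rpow_add two_pos, ← Real.rpow_add two_pos]; congr 1; ring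
    _ < 1 := by
        apply Real.rpow_lt_one_of_one_lt_of_neg one_lt_two
        have : (0 : ℝ) < n := by exact_mod_cast hn
        nlinarith

theorem exists_isEtaStable {A B : Type*} [Fintype A] [Fintype B] [MeasurableSpace A]
    [DiscreteMeasurableSpace A] [Nonempty B] (P : A → PMF B) {lam η Ω Γ R ρ : ℝ}
    (hlam : 1 < lam) (hη : 0 < η) (hΩ : 0 ≤ Ω) (hΓ : 0 ≤ Γ) (hR : Real.logb 2 lam < R) (Q : PMF A)
    (h0 : 0 ≤ ρ) (h1 : ρ ≤ 1) (hE : η * Real.logb 2 lam < gallagerE0 P Q ρ - ρ * R) :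
    ∃ (n : ℕ) (hn : 0 < n) (Δ : ℝ) (C : Controller (Labels n A) B), 0 < Δ ∧
      IsMLTrellisController P lam Ω Δ n C ∧
      IsEtaStable (labelLaw n Q) P lam Ω Γ η (latticeObserver n hn Δ) C := by
  have hlam0 : 0 ≤ lam := by linarith
  obtain ⟨n, hn, hbr⟩ := exists_blockLength hlam hR
  have hD := noiseRadius_nonneg hlam0 hΩ n
  -- The bins are wide compared with the observation noise and with the accumulated disturbances,
  -- so that an edge of the trellis has little more than `2 * lam ^ n` continuations.
  obtain ⟨Δ, hΔdef⟩ : ∃ Δ, Δ = 2 * Γ + 4 * noiseRadius lam Ω n + 1 := ⟨_, rfl⟩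
  have hΔ : 0 < Δ := by linarith
  obtain ⟨C, hML, hC⟩ := exists_causal_isMLTrellisController (B := B) P hlam0 hΩ hΔ hn
  set br := 4 * edgeRadius lam Ω Δ n / Δ + 1 with hbrdef
  have hr : 0 ≤ edgeRadius lam Ω Δ n :=
    (half_pos hΔ).le.trans (half_le_edgeRadius hlam0 hΩ hΔ n)
  have hbr' : br ≤ 2 * lam ^ n + 4 := by
    have : 4 * edgeRadius lam Ω Δ n / Δ ≤ 2 * lam ^ n + 3 := by
      rw [div_le_iff₀ hΔ, edgeRadius]; linarith
    linarith
  have hs : 0 ≤ 1 / (1 + ρ) := by positivity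
  have hsρ : 1 / (1 + ρ) + 1 / (1 + ρ) * ρ = 1 := by field_simp
  let L : (ℕ → ℝ) → (ℕ → ℝ) → Loop A B n := fun w ν => ⟨P, lam, Ω, Δ, C, w, ν⟩
  have hratio := ratio_lt_one (η := η) hlam hn h0 hE (by positivity : 0 ≤ br) (hbr'.trans hbr)
  rw [← sum_rpow_eq_ofReal_two_rpow P Q h0, ← sum_lintegral_wordProb_rpow P Q hs h0] at hratio
  set x := ENNReal.ofReal ((lam ^ n) ^ η) * ((∑ y : Fin n → B, (∫⁻ a, wordProb P a y ^ (1 / (1 + ρ))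
    ∂(Measure.pi fun _ => Q.toMeasure)) ^ (1 + ρ)) * ENNReal.ofReal br ^ ρ) with hx
  have hfin : ENNReal.ofReal ((lam ^ n * (L 0 0).stateConst + noiseRadius lam Ω n) ^ η) *
      ∑' d : ℕ, x ^ d ≠ ∞ := by
    rw [ENNReal.tsum_geometric]
    exact ENNReal.mul_ne_top ENNReal.ofReal_ne_top
      (ENNReal.inv_ne_top.2 (tsub_pos_of_lt hratio).ne')
  -- The constant of `L 0 0` serves for all `w` and `ν`, on which `stateConst` does not depend.
  refine ⟨n, hn, Δ, C, hΔ, hML, ENNReal.toNNReal (ENNReal.ofReal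
    ((lam ^ n * (L 0 0).stateConst + noiseRadius lam Ω n) ^ η) * ∑' d : ℕ, x ^ d),
    fun w ν hw hν t => ?_⟩
  have hL : (L w ν).Admissible Γ :=
    ⟨hlam, hn, hΩ, hΔ, by simp only [L]; linarith, hw, hν, hC, hML⟩
  have h2 := Loop.stateMoment_le hL (labelLaw n Q) hη.le (t / n) (Nat.mod_lt t hn)
  rw [Nat.div_add_mod'] at h2
  rw [ENNReal.coe_toNNReal hfin]
  exact h2.trans (Loop.lintegral_sampled_moment_le hL Q hη.le hs h0 h1 hsρ (t / n))

end ControlOverDMC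

theorem mainTheorem6 {A B : Type*} [Fintype A] [Fintype B]
    [MeasurableSpace A] [DiscreteMeasurableSpace A]
    (P : A → PMF B) (lam η Ω Γ R : ℝ)
    (hlam : 1 < lam) (hη : 0 < η) (hΩ : 0 ≤ Ω) (hΓ : 0 ≤ Γ)
    (hR : Real.logb 2 lam < R)
    (hE : η * Real.logb 2 lam < ControlOverDMC.randomCodingExponent P R) :
    (∃ Q : PMF A, ControlOverDMC.IsOptimalInput P R Q) ∧
    ∀ Q : PMF A, ControlOverDMC.IsOptimalInput P R Q →
      ∃ (n : ℕ) (hn : 0 < n) (Δ : ℝ) (C : ControlOverDMC.Controller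
          (ControlOverDMC.Labels n A) B),
        0 < Δ ∧
        ControlOverDMC.IsMLTrellisController P lam Ω Δ n C ∧
        ControlOverDMC.IsEtaStable (ControlOverDMC.labelLaw n Q) P lam Ω Γ η
          (ControlOverDMC.latticeObserver n hn Δ) C := by
  have hA : Nonempty A := by
    -- Without an input letter the supremum defining the exponent is empty, hence `0`.
    by_contra hA
    have : IsEmpty (PMF A) := ⟨fun Q => hA ⟨Q.support_nonempty.choose⟩⟩
    rw [ControlOverDMC.randomCodingExponent, Real.iSup_of_isEmpty] at hE
    exact hE.not_ge (mul_nonneg hη.le (Real.logb_nonneg one_lt_two hlam.le))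
  have hB : Nonempty B := ⟨(P (Classical.arbitrary A)).support_nonempty.choose⟩
  refine ⟨ControlOverDMC.exists_isOptimalInput P R, fun Q hQ => ?_⟩
  obtain ⟨ρ, ⟨h0, h1⟩, hρ⟩ := hQ.exists_lt_gallagerE0 hE
  exact ControlOverDMC.exists_isEtaStable P hlam hη hΩ hΓ hR Q h0 h1 hρ
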